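/- Let $dg$ be the Haar measure of $SO(3)$ with total mass $1$, let $K\cong SO(2)$ be the isotropy group of the north pole $x_0\in S^2$, and for $s\in\mathbb Z$ let $\chi_s$ be the character of $K$ with $\chi_s(k)=e^{is\theta}$ when $k$ is the rotation by the angle $\theta$ about the vertical axis. A function $f:SO(3)\to\mathbb C$ is of type $s$ if $f(gk)=\chi_s(k^{-1})f(g)$ for all $g\in SO(3)$, $k\in K$. Let $D^\ell=(D^\ell_{m,n})_{-\ell\le m,n\le \ell}$, $\ell\ge 0$, be Wigner's $D$ matrices, that is, the $(2\ell+1)$-dimensional irreducible unitary representations of $SO(3)$ in the standard orthonormal bases $v_{-\ell},\dots,v_\ell$ for which $D^\ell(k)v_m=\chi_m(k)v_m$, $k\in K$. For $f\in L^2(SO(3))$ put $\widehat f(\ell)_{i,j}=\sqrt{2\ell+1}\int_{SO(3)} f(g)\,D^\ell_{i,j}(g^{-1})\,dg$. Let $\xi_s$ be the homogeneous line bundle over $S^2$ with total space $SO(3)\times_s\mathbb C$, the set of orbits $\theta(g,z)=\{(gk,\chi_s(k^{-1})z): k\in K\}$ of $SO(3)\times\mathbb C$ under $K$, projection $\theta(g,z)\mapsto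 gx_0$, and fibre scalar product $\langle\theta(g,z),\theta(g,w)\rangle=z\overline w$. Let $L^2(\xi_s)$ be the space of its square integrable sections, with scalar product $\langle u,v\rangle=\int_{S^2}\langle u(x),v(x)\rangle\,dx$, where $dx$ is the rotation invariant measure of total mass $4\pi$. For $\ell\ge|s|$ and $-\ell\le m\le\ell$ let the spin $-s$ spherical harmonic be the section $${}_{-s}Y_{\ell,m}(gx_0)=\theta\Bigl(g,\sqrt{\tfrac{2\ell+1}{4\pi}}\;\overline{D^\ell_{m,s}(g)}\Bigr).$$ 1. For every $s\in\mathbb Z$ and every square integrable function $f$ of type $s$ on $SO(3)$, $$f=\sum_{\ell\ge|s|}\sqrt{2\ell+1}\sum_{m=-\ell}^{\ell}\widehat f(\ell)_{-s,m}\,D^\ell_{m,-s},$$ where the functions $D^\ell_{m,-s}$ are in $L^2(SO(3))$ and the series converges unconditionally in $L^2(SO(3))$. 2. If $s\ne s'$, and $f$, $f'$ are square integrable functions of type $s$ and of type $s'$ respectively, then $\int_{SO(3)} f\,\overline{f'}\,dg=0$. 3. For every $s\in\mathbb Z$ the sections ${}_{-s}Y_{\ell,m}$, $\ell\ge|s|$,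 $-\ell\le m\le\ell$, form an orthonormal basis of $L^2(\xi_s)$: they are square integrable and orthonormal, and every square integrable section $u$ of $\xi_s$ is the unconditional sum $u=\sum_{\ell\ge|s|}\sum_{m=-\ell}^{\ell}\langle u,{}_{-s}Y_{\ell,m}\rangle\;{}_{-s}Y_{\ell,m}$ in $L^2(\xi_s)$. -/

import Mathlib

open MeasureTheory Filter Topology
open scoped Matrix ComplexConjugate

noncomputable section

namespace SpinSphere

/-! ### The group `SO(3)`, the sphere, and the isotropy group of the north pole -/

/-- The rotation group `SO(3)`. -/
abbrev SO3 : Type := Matrix.specialOrthogonalGroup (Fin 3) ℝ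

/-- The group `SU(2)`. -/
abbrev SU2 : Type := Matrix.specialUnitaryGroup (Fin 2) ℂ

/-- The unit sphere of Euclidean three-space. -/
abbrev S2 : Type := Metric.sphere (0 : EuclideanSpace ℝ (Fin 3)) 1

theorem SO3.mul_transpose (g : SO3) : g.1 * g.1ᵀ = 1 :=
  (Matrix.mem_orthogonalGroup_iff (Fin 3) ℝ).1 (Matrix.mem_specialOrthogonalGroup_iff.1 g.2).1

theorem SO3.transpose_mul (g : SO3) : g.1ᵀ * g.1 = 1 :=
  (Matrix.mem_orthogonalGroup_iff' (Fin 3) ℝ).1 (Matrix.mem_specialOrthogonalGroup_iff.1 g.2).1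

theorem SO3.det_eq (g : SO3) : g.1.det = 1 := (Matrix.mem_specialOrthogonalGroup_iff.1 g.2).2

theorem SO3.mem_of {A : Matrix (Fin 3) (Fin 3) ℝ} (h : A * Aᵀ = 1) (hd : A.det = 1) :
    A ∈ Matrix.specialOrthogonalGroup (Fin 3) ℝ :=
  Matrix.mem_specialOrthogonalGroup_iff.2 ⟨(Matrix.mem_orthogonalGroup_iff (Fin 3) ℝ).2 h, hd⟩

theorem SO3.coe_inv (g : SO3) : (g⁻¹).1 = g.1ᵀ := rfl

instance : IsTopologicalGroup SO3 where
  continuous_inv := by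
    refine Continuous.subtype_mk ?_ _
    exact (continuous_subtype_val (p := fun A => A ∈ Matrix.specialOrthogonalGroup (Fin 3) ℝ)).matrix_transpose

theorem SO3.isCompact : IsCompact
    (Matrix.specialOrthogonalGroup (Fin 3) ℝ : Set (Matrix (Fin 3) (Fin 3) ℝ)) := by
  have hbox : IsCompact (Set.pi Set.univ fun _ : Fin 3 => Set.pi Set.univ fun _ : Fin 3 =>
      Set.Icc (-1 : ℝ) 1) :=
    isCompact_univ_pi fun _ => isCompact_univ_pi fun _ => isCompact_Icc
  have hset : (Matrix.specialOrthogonalGroup (Fin 3) ℝ : Set (Matrix (Fin 3) (Fin 3) ℝ)) =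
      {A | A * Aᵀ = 1} ∩ {A | A.det = 1} := by
    ext A
    exact ⟨fun h => ⟨SO3.mul_transpose ⟨A, h⟩, SO3.det_eq ⟨A, h⟩⟩, fun h => SO3.mem_of h.1 h.2⟩
  refine IsCompact.of_isClosed_subset hbox ?_ ?_
  · rw [hset]
    exact (isClosed_eq (continuous_id.matrix_mul continuous_id.matrix_transpose)
      continuous_const).inter (isClosed_eq continuous_id.matrix_det continuous_const)
  · intro A hA i _ j _
    have h := congrFun (congrFun (SO3.mul_transpose ⟨A, hA⟩) i) i
    simp only [Matrix.mul_apply, Matrix.transpose_apply, Matrix.one_apply_eq,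
      Fin.sum_univ_three] at h
    refine abs_le.1 (abs_le_one_iff_mul_self_le_one.2 ?_)
    fin_cases j <;> simp only [Fin.zero_eta, Fin.mk_one, Fin.reduceFinMk] <;>
      nlinarith [mul_self_nonneg (A i 0), mul_self_nonneg (A i 1), mul_self_nonneg (A i 2)]

instance : CompactSpace SO3 := isCompact_iff_compactSpace.1 SO3.isCompact

instance : MeasurableSpace SO3 := borel SO3

instance : BorelSpace SO3 := ⟨rfl⟩

/-- The Haar measure of `SO(3)` with total mass one. -/
def haarSO3 : Measure SO3 := Measure.haarMeasure ⊤

/-- Rotations act on the sphere by matrix-vector multiplication. -/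
instance : MulAction SO3 S2 where
  smul g x := ⟨WithLp.toLp 2 (g.1 *ᵥ x.1.ofLp), by
    have hx : ‖x.1‖ = 1 := by simp
    rw [mem_sphere_zero_iff_norm]
    refine Eq.trans ?_ hx
    rw [EuclideanSpace.norm_eq, EuclideanSpace.norm_eq]
    congr 1
    have h : (g.1 *ᵥ x.1.ofLp) ⬝ᵥ (g.1 *ᵥ x.1.ofLp) = x.1.ofLp ⬝ᵥ x.1.ofLp := by
      rw [Matrix.dotProduct_mulVec, Matrix.vecMul_mulVec, SO3.transpose_mul, Matrix.vecMul_one]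
    simpa [dotProduct, sq] using h⟩
  one_smul x := by
    apply Subtype.ext
    change WithLp.toLp 2 ((1 : Matrix (Fin 3) (Fin 3) ℝ) *ᵥ x.1.ofLp) = x.1
    simp
  mul_smul g h x := by
    apply Subtype.ext
    change WithLp.toLp 2 ((g.1 * h.1) *ᵥ x.1.ofLp) = WithLp.toLp 2 (g.1 *ᵥ (h.1 *ᵥ x.1.ofLp))
    rw [Matrix.mulVec_mulVec]

theorem smul_coe (g : SO3) (x : S2) : (g • x).1 = WithLp.toLp 2 (g.1 *ᵥ x.1.ofLp) := rfl

/-- The north pole `(0, 0, 1)`. -/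
def northPole : S2 := ⟨EuclideanSpace.single 2 1, by simp⟩

theorem smul_northPole_apply (g : SO3) (i : Fin 3) : (g • northPole).1 i = g.1 i 2 := by
  simp [smul_coe, northPole]

/-- The rotation-invariant measure of total mass `4π` on the sphere. -/
def sphereMeasure : Measure S2 :=
  ENNReal.ofReal (4 * Real.pi) • haarSO3.map (fun g => g • northPole)

/-- The isotropy group `K ≅ SO(2)` of the north pole. -/
abbrev K : Subgroup SO3 := MulAction.stabilizer SO3 northPole

/-- A rotation fixing the north pole is block diagonal, with a plane rotation as first block. -/
theorem K.entries (k : K) :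
    k.1.1 0 2 = 0 ∧ k.1.1 1 2 = 0 ∧ k.1.1 2 2 = 1 ∧ k.1.1 2 0 = 0 ∧ k.1.1 2 1 = 0 ∧
      k.1.1 0 1 = -k.1.1 1 0 ∧ k.1.1 1 1 = k.1.1 0 0 ∧
      k.1.1 0 0 ^ 2 + k.1.1 1 0 ^ 2 = 1 := by
  have hk : k.1 • northPole = northPole := k.2
  have h0 := smul_northPole_apply k.1 0
  have h1 := smul_northPole_apply k.1 1
  have h2 := smul_northPole_apply k.1 2
  rw [hk] at h0 h1 h2
  simp only [northPole, PiLp.single_apply, Fin.reduceEq, if_true, if_false] at h0 h1 h2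
  have e22 := congrFun (congrFun (SO3.mul_transpose k.1) 2) 2
  have c00 := congrFun (congrFun (SO3.transpose_mul k.1) 0) 0
  have c01 := congrFun (congrFun (SO3.transpose_mul k.1) 0) 1
  have hd := SO3.det_eq k.1
  rw [Matrix.det_fin_three] at hd
  simp only [Matrix.mul_apply, Matrix.transpose_apply, Matrix.one_apply, Fin.sum_univ_three,
    Fin.reduceEq, if_true, if_false] at e22 c00 c01
  rw [← h0, ← h1, ← h2] at hd
  rw [← h2] at e22
  have h20 : k.1.1 2 0 = 0 := by nlinarith [sq_nonneg (k.1.1 2 0), sq_nonneg (k.1.1 2 1)]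
  have h21 : k.1.1 2 1 = 0 := by nlinarith [sq_nonneg (k.1.1 2 0), sq_nonneg (k.1.1 2 1)]
  rw [h20] at c00 c01 hd
  rw [h21] at c01 hd
  refine ⟨h0.symm, h1.symm, h2.symm, h20, h21, ?_, ?_, by linarith⟩
  · linear_combination (-k.1.1 0 1) * c00 + k.1.1 0 0 * c01 - k.1.1 1 0 * hd
  · linear_combination (-k.1.1 1 1) * c00 + k.1.1 1 0 * c01 + k.1.1 0 0 * hd

/-- The identification of `K` with the unit circle: the rotation by the angle `θ` about the
vertical axis is sent to `exp (i θ) = cos θ + i sin θ`. -/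
def axialPhase : K →* Circle where
  toFun k := ⟨⟨k.1.1 0 0, k.1.1 1 0⟩, by
    obtain ⟨-, -, -, -, -, -, -, h⟩ := K.entries k
    change _ ∈ Metric.sphere (0 : ℂ) 1
    rw [mem_sphere_zero_iff_norm, ← sq_eq_sq₀ (norm_nonneg _) zero_le_one, ← Complex.normSq_eq_norm_sq,
      Complex.normSq_apply]
    simpa [sq] using h⟩
  map_one' := by
    apply Subtype.ext
    apply Complex.ext <;> simp
  map_mul' k k' := by
    obtain ⟨-, -, -, h20, h21, h01, h11, -⟩ := K.entries k
    obtain ⟨-, -, -, h20', h21', h01', h11', -⟩ := K.entries k'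
    apply Circle.ext
    change (⟨(k * k').1.1 0 0, (k * k').1.1 1 0⟩ : ℂ) =
      ⟨k.1.1 0 0, k.1.1 1 0⟩ * ⟨k'.1.1 0 0, k'.1.1 1 0⟩
    apply Complex.ext <;>
      simp [Matrix.mul_apply, Fin.sum_univ_three, h01, h11, h20'] <;> ring

/-- The linear character `χ_s` of `K`: `χ_s (rotation by θ) = exp (i s θ)`. -/
def chi (s : ℤ) : K →* Circle := axialPhase ^ s

/-- Functions of type `s` on `SO(3)`. -/
def IsOfType (s : ℤ) (f : SO3 → ℂ) : Prop :=
  ∀ (g : SO3) (k : K), f (g * k) = (chi s k⁻¹ : ℂ) * f g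

/-! ### Wigner's `D` matrices

`ℝ³` is identified with the traceless Hermitian `2 × 2` matrices, and `SU(2)` acts on these by
conjugation. The induced map `SU(2) → SO(3)` is the double covering, and `D^ℓ` is the irreducible
representation of `SU(2)` on homogeneous polynomials of degree `2ℓ`, which factors through it. -/

/-- The traceless Hermitian matrix attached to a vector of `ℝ³`. -/
def hermitian (x : Fin 3 → ℝ) : Matrix (Fin 2) (Fin 2) ℂ :=
  !![(x 2 : ℂ), x 0 + x 1 * Complex.I; x 0 - x 1 * Complex.I, -x 2]

/-- `U ∈ SU(2)` lies above the rotation `g`. -/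
def Covers (U : SU2) (g : SO3) : Prop :=
  ∀ x : Fin 3 → ℝ, hermitian (g.1 *ᵥ x) = U.1 * hermitian x * U.1ᴴ

theorem SU2.mul_conjTranspose (U : SU2) : U.1 * U.1ᴴ = 1 :=
  Matrix.mem_unitaryGroup_iff.1 (Matrix.mem_specialUnitaryGroup_iff.1 U.2).1

theorem SU2.conjTranspose_mul (U : SU2) : U.1ᴴ * U.1 = 1 :=
  Matrix.mem_unitaryGroup_iff'.1 (Matrix.mem_specialUnitaryGroup_iff.1 U.2).1

theorem SU2.det_eq (U : SU2) : U.1.det = 1 := (Matrix.mem_specialUnitaryGroup_iff.1 U.2).2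

theorem Covers.mul {U V : SU2} {g h : SO3} (hU : Covers U g) (hV : Covers V h) :
    Covers (U * V) (g * h) := by
  intro x
  change hermitian ((g.1 * h.1) *ᵥ x) = (U.1 * V.1) * hermitian x * (U.1 * V.1)ᴴ
  rw [← Matrix.mulVec_mulVec, hU, hV, Matrix.conjTranspose_mul]
  simp only [Matrix.mul_assoc]

/-- The rotation by the angle `θ` about the third axis. -/
def rotZ (θ : ℝ) : SO3 :=
  ⟨!![Real.cos θ, -Real.sin θ, 0; Real.sin θ, Real.cos θ, 0; 0, 0, 1], by
    apply SO3.mem_of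
    · have := Real.sin_sq_add_cos_sq θ
      ext i j
      fin_cases i <;> fin_cases j <;> simp [Matrix.mul_apply, Fin.sum_univ_three] <;> nlinarith
    · have := Real.sin_sq_add_cos_sq θ
      simp [Matrix.det_fin_three]
      nlinarith⟩

/-- The rotation by the angle `θ` about the second axis. -/
def rotY (θ : ℝ) : SO3 :=
  ⟨!![Real.cos θ, 0, Real.sin θ; 0, 1, 0; -Real.sin θ, 0, Real.cos θ], by
    apply SO3.mem_of
    · have := Real.sin_sq_add_cos_sq θ
      ext i j
      fin_cases i <;> fin_cases j <;> simp [Matrix.mul_apply, Fin.sum_univ_three] <;> nlinarith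
    · have := Real.sin_sq_add_cos_sq θ
      simp [Matrix.det_fin_three]
      nlinarith⟩

/-- The diagonal matrix in `SU(2)` with first entry `u`. -/
def phase (u : Circle) : SU2 :=
  ⟨!![(u : ℂ), 0; 0, conj (u : ℂ)], by
    have h : (u : ℂ) * conj (u : ℂ) = 1 := by simp [Complex.mul_conj]
    refine Matrix.mem_specialUnitaryGroup_iff.2 ⟨Matrix.mem_unitaryGroup_iff.2 ?_, ?_⟩
    · ext i j
      fin_cases i <;> fin_cases j <;>
        simp [Matrix.mul_apply, Matrix.star_apply, h, mul_comm (conj (u : ℂ))]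
    · simp [Matrix.det_fin_two, h]⟩

/-- The real rotation by the angle `θ / 2`, as an element of `SU(2)`. -/
def tilt (θ : ℝ) : SU2 :=
  ⟨!![(Real.cos (θ / 2) : ℂ), -Real.sin (θ / 2); Real.sin (θ / 2), Real.cos (θ / 2)], by
    have h : (Real.sin (θ / 2) : ℂ) ^ 2 + (Real.cos (θ / 2) : ℂ) ^ 2 = 1 := by
      exact_mod_cast Real.sin_sq_add_cos_sq (θ / 2)
    refine Matrix.mem_specialUnitaryGroup_iff.2 ⟨Matrix.mem_unitaryGroup_iff.2 ?_, ?_⟩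
    · ext i j
      fin_cases i <;> fin_cases j <;>
        simp [Matrix.mul_apply, Matrix.star_apply, Complex.conj_ofReal, -Complex.ofReal_cos,
          -Complex.ofReal_sin] <;> first | ring1 | linear_combination h
    · simp [Matrix.det_fin_two, -Complex.ofReal_cos, -Complex.ofReal_sin]
      linear_combination h⟩

theorem covers_phase (k : K) (u : Circle) (hu : u ^ 2 = axialPhase k) : Covers (phase u) k := by
  obtain ⟨h02, h12, h22, h20, h21, h01, h11, -⟩ := K.entries k
  have hu' : (u : ℂ) ^ 2 = (k.1.1 0 0 : ℂ) + k.1.1 1 0 * Complex.I := by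
    have := congrArg (fun z : Circle => (z : ℂ)) hu
    simp only [Circle.coe_pow] at this
    rw [this]
    change (⟨k.1.1 0 0, k.1.1 1 0⟩ : ℂ) = _
    apply Complex.ext <;> simp
  have hc : conj (u : ℂ) ^ 2 = (k.1.1 0 0 : ℂ) - k.1.1 1 0 * Complex.I := by
    rw [← map_pow, hu']
    simp [sub_eq_add_neg]
  have h1 : (u : ℂ) * conj (u : ℂ) = 1 := by simp [Complex.mul_conj]
  intro x
  ext i j
  fin_cases i <;> fin_cases j <;>
    simp [hermitian, phase, Matrix.mul_apply, Matrix.mulVec, dotProduct, Fin.sum_univ_three,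
      h02, h12, h22, h20, h21, h01, h11]
  · linear_combination (-(x 2 : ℂ)) * h1
  · linear_combination (-(x 0 + x 1 * Complex.I : ℂ)) * hu' - (x 1 * k.1.1 1 0 : ℂ) * Complex.I_sq
  · linear_combination (-(x 0 - x 1 * Complex.I : ℂ)) * hc - (x 1 * k.1.1 1 0 : ℂ) * Complex.I_sq
  · linear_combination (-(x 2 : ℂ)) * h1

theorem covers_tilt (θ : ℝ) : Covers (tilt θ) (rotY θ) := by
  have hc : Real.cos θ = Real.cos (θ / 2) ^ 2 - Real.sin (θ / 2) ^ 2 := by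
    rw [← Real.cos_two_mul']; ring_nf
  have hs : Real.sin θ = 2 * Real.sin (θ / 2) * Real.cos (θ / 2) := by
    rw [← Real.sin_two_mul]; ring_nf
  have h : (Real.sin (θ / 2) : ℂ) ^ 2 + (Real.cos (θ / 2) : ℂ) ^ 2 = 1 := by
    exact_mod_cast Real.sin_sq_add_cos_sq (θ / 2)
  intro x
  ext i j
  fin_cases i <;> fin_cases j <;>
    simp [hermitian, tilt, rotY, Matrix.mul_apply, Matrix.mulVec, dotProduct,
      Fin.sum_univ_three, -Complex.ofReal_cos, -Complex.ofReal_sin, Complex.conj_ofReal, hc, hs] <;>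
    generalize (Real.sin (θ / 2) : ℂ) = p at * <;> generalize (Real.cos (θ / 2) : ℂ) = q at *
  · ring
  · linear_combination (-(x 1 * Complex.I : ℂ)) * h
  · linear_combination (x 1 * Complex.I : ℂ) * h
  · ring

theorem rotZ_mem_K (θ : ℝ) : rotZ θ ∈ K := by
  rw [MulAction.mem_stabilizer_iff]
  apply Subtype.ext
  ext i
  rw [smul_northPole_apply]
  fin_cases i <;> simp [rotZ, northPole]

/-- `SO(3)` is transitive on the sphere, with half-angle lifts to `SU(2)`. -/
theorem exists_covers_smul_northPole (x : S2) :
    ∃ (g : SO3) (U : SU2), g • northPole = x ∧ Covers U g := by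
  have hx : x.1 0 ^ 2 + x.1 1 ^ 2 + x.1 2 ^ 2 = 1 := by
    have h : ‖x.1‖ = 1 := by simp
    rw [EuclideanSpace.norm_eq, Real.sqrt_eq_one] at h
    simpa [Fin.sum_univ_three] using h
  set w : ℂ := ⟨x.1 0, x.1 1⟩ with hw
  have hz : -1 ≤ x.1 2 ∧ x.1 2 ≤ 1 := by
    constructor <;> nlinarith [sq_nonneg (x.1 0), sq_nonneg (x.1 1)]
  have hn : ‖w‖ = Real.sin (Real.arccos (x.1 2)) := by
    rw [Real.sin_arccos, Complex.norm_eq_sqrt_sq_add_sq]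
    congr 1
    simp only [hw]
    linarith
  have hcos := Real.cos_arccos hz.1 hz.2
  have h0 : Real.sin (Real.arccos (x.1 2)) * Real.cos w.arg = x.1 0 := by
    rw [← hn, Complex.norm_mul_cos_arg]
  have h1 : Real.sin (Real.arccos (x.1 2)) * Real.sin w.arg = x.1 1 := by
    rw [← hn, Complex.norm_mul_sin_arg]
  obtain ⟨u, hu⟩ : ∃ u : Circle, u ^ 2 = axialPhase ⟨rotZ w.arg, rotZ_mem_K _⟩ := by
    refine ⟨Circle.exp ((axialPhase ⟨rotZ w.arg, rotZ_mem_K _⟩ : ℂ).arg / 2), ?_⟩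
    rw [sq, ← Circle.exp_add, add_halves, Circle.exp_arg]
  refine ⟨rotZ w.arg * rotY (Real.arccos (x.1 2)), phase u * tilt (Real.arccos (x.1 2)), ?_,
    (covers_phase _ u hu).mul (covers_tilt _)⟩
  apply Subtype.ext
  ext i
  rw [smul_northPole_apply]
  fin_cases i <;>
    simp [rotZ, rotY, hcos]
  · rw [mul_comm, h0]
  · rw [mul_comm, h1]

theorem exists_sq_eq (u : Circle) : ∃ v : Circle, v ^ 2 = u :=
  ⟨Circle.exp ((u : ℂ).arg / 2), by rw [sq, ← Circle.exp_add, add_halves, Circle.exp_arg]⟩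

/-- The covering `SU(2) → SO(3)` is surjective. -/
theorem exists_covers (g : SO3) : ∃ U : SU2, Covers U g := by
  obtain ⟨h, U, hh, hU⟩ := exists_covers_smul_northPole (g • northPole)
  have hk : h⁻¹ * g ∈ K := by
    rw [MulAction.mem_stabilizer_iff, mul_smul, ← hh, inv_smul_smul]
  obtain ⟨u, hu⟩ := exists_sq_eq (axialPhase ⟨h⁻¹ * g, hk⟩)
  refine ⟨U * phase u, ?_⟩
  have := hU.mul (covers_phase _ u hu)
  simpa using this

/-- Two elements of `SU(2)` above the same rotation differ by a sign. -/
theorem Covers.eq_or_neg {U V : SU2} {g : SO3} (hU : Covers U g) (hV : Covers V g) :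
    V.1 = U.1 ∨ V.1 = -U.1 := by
  set W : Matrix (Fin 2) (Fin 2) ℂ := U.1ᴴ * V.1 with hW
  have hcomm : ∀ x : Fin 3 → ℝ, W * hermitian x = hermitian x * W := by
    intro x
    have h := (hV x).symm.trans (hU x)
    calc W * hermitian x = U.1ᴴ * (V.1 * hermitian x * V.1ᴴ) * V.1 := by
          simp only [hW, Matrix.mul_assoc, SU2.conjTranspose_mul, Matrix.mul_one]
      _ = hermitian x * W := by
          rw [h]
          simp only [hW, ← Matrix.mul_assoc, SU2.conjTranspose_mul, Matrix.one_mul]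
  have hdet : W.det = 1 := by
    rw [hW, Matrix.det_mul, Matrix.det_conjTranspose, SU2.det_eq, SU2.det_eq]; simp
  have hVW : V.1 = U.1 * W := by
    rw [hW, ← Matrix.mul_assoc, SU2.mul_conjTranspose, Matrix.one_mul]
  have hz := hcomm ![0, 0, 1]
  have hx := hcomm ![1, 0, 0]
  have e01 : W 0 1 = 0 := by
    have := congrFun (congrFun hz 0) 1
    simp [hermitian, Matrix.mul_apply] at this
    linear_combination (-1 / 2 : ℂ) * this
  have e10 : W 1 0 = 0 := by
    have := congrFun (congrFun hz 1) 0
    simp [hermitian, Matrix.mul_apply] at this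
    linear_combination (1 / 2 : ℂ) * this
  have e11 : W 1 1 = W 0 0 := by
    have := congrFun (congrFun hx 0) 1
    simp [hermitian, Matrix.mul_apply] at this
    exact this.symm
  rw [Matrix.det_fin_two, e01, e10, e11] at hdet
  have hsq : (W 0 0 - 1) * (W 0 0 + 1) = 0 := by linear_combination hdet
  rcases mul_eq_zero.1 hsq with h | h
  · left
    have hone : W = 1 := by
      ext i j
      fin_cases i <;> fin_cases j <;> simp [e01, e10, e11, sub_eq_zero.1 h]
    rw [hVW, hone, Matrix.mul_one]
  · right
    have hone : W = -1 := by
      ext i j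
      fin_cases i <;> fin_cases j <;> simp [e01, e10, e11, eq_neg_of_add_eq_zero_left h]
    rw [hVW, hone, Matrix.mul_neg, Matrix.mul_one]

/-- The `(m, n)` entry, for `-ℓ ≤ m, n ≤ ℓ`, of the representation of `SU(2)` on homogeneous
polynomials `p (x, y)` of degree `2ℓ`, in which `U` maps `p` to `p ((x, y) U)`, with respect to the
orthonormal basis `v_m = x^(ℓ+m) y^(ℓ-m) / √((ℓ+m)! (ℓ-m)!)`: it is read off from the image
`(U₀₀ x + U₁₀ y)^(ℓ+n) (U₀₁ x + U₁₁ y)^(ℓ-n) / √((ℓ+n)! (ℓ-n)!)` of `v_n`, where `x = X`, `y = 1`. -/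
def spinEntry (ℓ : ℕ) (m n : ℤ) (U : SU2) : ℂ :=
  (Real.sqrt ((ℓ + m).toNat.factorial * (ℓ - m).toNat.factorial) /
      Real.sqrt ((ℓ + n).toNat.factorial * (ℓ - n).toNat.factorial) : ℝ) *
    ((Polynomial.C (U.1 0 0) * Polynomial.X + Polynomial.C (U.1 1 0)) ^ (ℓ + n).toNat *
      (Polynomial.C (U.1 0 1) * Polynomial.X + Polynomial.C (U.1 1 1)) ^ (ℓ - n).toNat).coeff
        (ℓ + m).toNat

/-- The entry `D^ℓ_{m,n}`, for `-ℓ ≤ m, n ≤ ℓ`, of Wigner's matrix `D^ℓ` at the rotation `g`.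
At the rotation with `z-y-z` Euler angles `α, β, γ` it equals `e^(imα) d^ℓ_{m,n}(β) e^(inγ)`, with
Wigner's small `d` matrix; in particular `D^ℓ(k) v_m = χ_m(k) v_m` for `k ∈ K`. -/
def wignerD (ℓ : ℕ) (m n : ℤ) (g : SO3) : ℂ := spinEntry ℓ m n (exists_covers g).choose

theorem spinEntry_eq_of_neg {ℓ : ℕ} {n : ℤ} (hn : |n| ≤ ℓ) (m : ℤ) {U V : SU2}
    (h : V.1 = -U.1) : spinEntry ℓ m n V = spinEntry ℓ m n U := by
  obtain ⟨h1, h2⟩ := abs_le.1 hn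
  unfold spinEntry
  congr 2
  simp only [h, Matrix.neg_apply, map_neg]
  have e : ∀ a b : Polynomial ℂ, -a * Polynomial.X + -b = -(a * Polynomial.X + b) := by
    intro a b; ring
  rw [e, e]
  generalize (Polynomial.C (U.1 0 0) * Polynomial.X + Polynomial.C (U.1 1 0)) = A
  generalize (Polynomial.C (U.1 0 1) * Polynomial.X + Polynomial.C (U.1 1 1)) = B
  rw [neg_pow A, neg_pow B]
  have hs : (ℓ + n).toNat + (ℓ - n).toNat = 2 * ℓ := by omega
  have hp : (-1 : Polynomial ℂ) ^ (ℓ + n).toNat * (-1) ^ (ℓ - n).toNat = 1 := by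
    rw [← pow_add, hs, pow_mul]; simp
  linear_combination A ^ (ℓ + n).toNat * B ^ (ℓ - n).toNat * hp

/-- `D^ℓ` does not depend on the choice of the element of `SU(2)` above a rotation. -/
theorem wignerD_eq {ℓ : ℕ} {n : ℤ} (hn : |n| ≤ ℓ) (m : ℤ) {U : SU2} {g : SO3}
    (hU : Covers U g) : wignerD ℓ m n g = spinEntry ℓ m n U := by
  rcases hU.eq_or_neg (exists_covers g).choose_spec with h | h
  · unfold wignerD
    rw [Subtype.ext h]
  · exact spinEntry_eq_of_neg hn m h

/-- The `n`-th column of `D^ℓ` transforms under `K` on the right according to `χ_n`. -/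
theorem wignerD_mul {ℓ : ℕ} {n : ℤ} (hn : |n| ≤ ℓ) (m : ℤ) (g : SO3) (k : K) :
    wignerD ℓ m n (g * k) = wignerD ℓ m n g * chi n k := by
  obtain ⟨h1, h2⟩ := abs_le.1 hn
  obtain ⟨U, hU⟩ := exists_covers g
  obtain ⟨u, hu⟩ := exists_sq_eq (axialPhase k)
  rw [wignerD_eq hn m hU, wignerD_eq hn m (hU.mul (covers_phase k u hu))]
  have hchi : (chi n k : ℂ) = (u : ℂ) ^ (ℓ + n).toNat * conj (u : ℂ) ^ (ℓ - n).toNat := by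
    have hne : (u : ℂ) ≠ 0 := Circle.coe_ne_zero u
    have e : chi n k = u ^ (2 * n) := by
      rw [zpow_mul, zpow_ofNat, hu]; rfl
    rw [e, Circle.coe_zpow, ← Circle.coe_inv_eq_conj, Circle.coe_inv, inv_pow, ← zpow_natCast,
      ← zpow_natCast, ← zpow_neg, ← zpow_add₀ hne]
    congr 1
    omega
  have e00 : (U * phase u).1 0 0 = U.1 0 0 * u := by simp [phase, Matrix.mul_apply]
  have e10 : (U * phase u).1 1 0 = U.1 1 0 * u := by simp [phase, Matrix.mul_apply]
  have e01 : (U * phase u).1 0 1 = U.1 0 1 * conj (u : ℂ) := by simp [phase, Matrix.mul_apply]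
  have e11 : (U * phase u).1 1 1 = U.1 1 1 * conj (u : ℂ) := by simp [phase, Matrix.mul_apply]
  unfold spinEntry
  rw [e00, e10, e01, e11, mul_assoc]
  congr 1
  rw [hchi, ← Polynomial.coeff_mul_C]
  congr 1
  simp only [map_mul, map_pow]
  generalize Polynomial.C (U.1 0 0) = a
  generalize Polynomial.C (U.1 1 0) = c
  generalize Polynomial.C (U.1 0 1) = b
  generalize Polynomial.C (U.1 1 1) = d
  generalize Polynomial.C (u : ℂ) = p
  generalize Polynomial.C (conj (u : ℂ)) = q
  have r1 : a * p * Polynomial.X + c * p = (a * Polynomial.X + c) * p := by ring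
  have r2 : b * q * Polynomial.X + d * q = (b * Polynomial.X + d) * q := by ring
  rw [r1, r2, mul_pow, mul_pow]
  ring

/-! ### The homogeneous line bundle `ξ_s` -/

/-- Two pairs are equivalent if they lie on the same orbit of `K`, acting on `SO(3) × ℂ` by
`k (g, z) = (g k, χ_s (k⁻¹) z)`. -/
def orbitSetoid (s : ℤ) : Setoid (SO3 × ℂ) where
  r p q := ∃ k : K, q = (p.1 * k, (chi s k⁻¹ : ℂ) * p.2)
  iseqv :=
    { refl := fun p => ⟨1, by simp⟩
      symm := by
        rintro ⟨g, z⟩ _ ⟨k, rfl⟩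
        exact ⟨k⁻¹, by simp⟩
      trans := by
        rintro ⟨g, z⟩ _ _ ⟨k, rfl⟩ ⟨l, rfl⟩
        refine ⟨k * l, Prod.ext ?_ ?_⟩
        · exact mul_assoc g k.1 l.1
        · simp only [map_mul, map_inv, mul_inv, Circle.coe_mul]
          ring }

/-- The total space `SO(3) ×_s ℂ` of the line bundle `ξ_s`. -/
def Total (s : ℤ) : Type := Quotient (orbitSetoid s)

instance (s : ℤ) : TopologicalSpace (Total s) :=
  inferInstanceAs (TopologicalSpace (Quotient (orbitSetoid s)))

instance (s : ℤ) : MeasurableSpace (Total s) := borel (Total s)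

instance (s : ℤ) : BorelSpace (Total s) := ⟨rfl⟩

/-- The orbit `θ(g, z)`. -/
def theta (s : ℤ) (g : SO3) (z : ℂ) : Total s := Quotient.mk (orbitSetoid s) (g, z)

theorem theta_eq_iff {s : ℤ} {g g' : SO3} {z z' : ℂ} :
    theta s g z = theta s g' z' ↔ ∃ k : K, g' = g * k ∧ z' = (chi s k⁻¹ : ℂ) * z := by
  exact (Quotient.eq (r := orbitSetoid s)).trans (exists_congr fun k => Prod.ext_iff)

/-- The bundle projection, `θ(g, z) ↦ g x₀` with `x₀` the north pole. -/
def proj (s : ℤ) : Total s → S2 :=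
  Quotient.lift (fun p => p.1 • northPole) (by
    rintro ⟨g, z⟩ _ ⟨k, rfl⟩
    have hk : k.1 • northPole = northPole := k.2
    simp [mul_smul, hk])

theorem proj_theta (s : ℤ) (g : SO3) (z : ℂ) : proj s (theta s g z) = g • northPole := rfl

/-- The fibre of `ξ_s` over `x`. -/
@[ext]
structure Fiber (s : ℤ) (x : S2) where
  /-- the underlying point of the total space -/
  pt : Total s
  proj_pt : proj s pt = x

/-- The point `θ(g, z)` in the fibre over `x = g x₀`. -/
def Fiber.mk' (s : ℤ) {x : S2} (g : SO3) (hg : g • northPole = x) (z : ℂ) : Fiber s x :=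
  ⟨theta s g z, hg⟩

/-- Two rotations over the same point differ by an element of `K`. -/
theorem exists_mul_eq {x : S2} {g h : SO3} (hg : g • northPole = x) (hh : h • northPole = x) :
    ∃ k : K, h = g * k := by
  refine ⟨⟨g⁻¹ * h, ?_⟩, by simp⟩
  rw [MulAction.mem_stabilizer_iff, mul_smul, hh, ← hg, inv_smul_smul]

/-- Every rotation `g` over `x` identifies the fibre over `x` with `ℂ`, by `z ↦ θ(g, z)`. -/
theorem Fiber.mk'_bijective (s : ℤ) {x : S2} (g : SO3) (hg : g • northPole = x) :
    Function.Bijective (Fiber.mk' s g hg) := by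
  constructor
  · intro z w h
    obtain ⟨k, hk, hz⟩ := theta_eq_iff.1 (congrArg Fiber.pt h)
    have : k = 1 := by
      apply Subtype.ext
      simpa using hk.symm
    simpa [this] using hz.symm
  · rintro ⟨p, hp⟩
    obtain ⟨⟨h, w⟩, rfl⟩ := Quotient.exists_rep p
    obtain ⟨k, rfl⟩ := exists_mul_eq (show h • northPole = x from hp) hg
    refine ⟨(chi s k⁻¹ : ℂ) * w, Fiber.ext ?_⟩
    exact (theta_eq_iff.2 ⟨k, rfl, rfl⟩ : theta s h w = _).symm

/-- A rotation taking the north pole to `x`. -/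
def frame (x : S2) : SO3 := (exists_covers_smul_northPole x).choose

theorem frame_smul (x : S2) : frame x • northPole = x :=
  (exists_covers_smul_northPole x).choose_spec.choose_spec.1

/-- The identification of the fibre over `x` with `ℂ` given by `frame x`. -/
def Fiber.coord (s : ℤ) (x : S2) : Fiber s x ≃ ℂ :=
  (Equiv.ofBijective _ (Fiber.mk'_bijective s (frame x) (frame_smul x))).symm

/-- The vector space structure of the fibres; it does not depend on the rotation used to
identify the fibre with `ℂ`. -/
instance (s : ℤ) (x : S2) : AddCommGroup (Fiber s x) := (Fiber.coord s x).addCommGroup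

instance (s : ℤ) (x : S2) : Module ℂ (Fiber s x) := (Fiber.coord s x).module ℂ

/-- The identification of the fibre over `x` with `ℂ` given by `frame x`, as a linear map. -/
def Fiber.linearCoord (s : ℤ) (x : S2) : Fiber s x ≃ₗ[ℂ] ℂ := (Fiber.coord s x).linearEquiv ℂ

instance (s : ℤ) (x : S2) : NormedAddCommGroup (Fiber s x) :=
  NormedAddCommGroup.induced (Fiber s x) ℂ (Fiber.linearCoord s x) (Fiber.linearCoord s x).injective

/-- The scalar product of the fibres, `⟨θ(g, z), θ(g, w)⟩ = ⟨z, w⟩`; it does not depend on the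
rotation `g`. As usual here, `inner ℂ η ζ` is linear in `ζ`. -/
instance (s : ℤ) (x : S2) : InnerProductSpace ℂ (Fiber s x) where
  norm_smul_le c η := by
    change ‖Fiber.linearCoord s x (c • η)‖ ≤ ‖c‖ * ‖Fiber.linearCoord s x η‖
    simp
  inner η ζ := inner ℂ (Fiber.linearCoord s x η) (Fiber.linearCoord s x ζ)
  norm_sq_eq_re_inner η := norm_sq_eq_re_inner (𝕜 := ℂ) (Fiber.linearCoord s x η)
  conj_inner_symm η ζ := inner_conj_symm _ _
  add_left η ζ ω := by
    rw [map_add, inner_add_left]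
  smul_left η ζ c := by
    rw [map_smul, inner_smul_left]

theorem Fiber.linearCoord_mk' (s : ℤ) {x : S2} (g : SO3) (hg : g • northPole = x) :
    ∃ u : Circle, ∀ z : ℂ, Fiber.linearCoord s x (Fiber.mk' s g hg z) = u * z := by
  obtain ⟨k, hk⟩ := exists_mul_eq hg (frame_smul x)
  refine ⟨chi s k⁻¹, fun z => ?_⟩
  change (Equiv.ofBijective _ (Fiber.mk'_bijective s (frame x) (frame_smul x))).symm _ = _
  rw [Equiv.symm_apply_eq]
  apply Fiber.ext
  exact (theta_eq_iff.2 ⟨k, hk, rfl⟩ : theta s g z = theta s (frame x) _)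

theorem Fiber.mk'_add (s : ℤ) {x : S2} (g : SO3) (hg : g • northPole = x) (z w : ℂ) :
    Fiber.mk' s g hg (z + w) = Fiber.mk' s g hg z + Fiber.mk' s g hg w := by
  obtain ⟨u, hu⟩ := Fiber.linearCoord_mk' s g hg
  apply (Fiber.linearCoord s x).injective
  rw [map_add, hu, hu, hu, mul_add]

theorem Fiber.mk'_smul (s : ℤ) {x : S2} (g : SO3) (hg : g • northPole = x) (c z : ℂ) :
    Fiber.mk' s g hg (c * z) = c • Fiber.mk' s g hg z := by
  obtain ⟨u, hu⟩ := Fiber.linearCoord_mk' s g hg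
  apply (Fiber.linearCoord s x).injective
  rw [map_smul, hu, hu, smul_eq_mul, mul_left_comm]

theorem Fiber.inner_mk' (s : ℤ) {x : S2} (g : SO3) (hg : g • northPole = x) (z w : ℂ) :
    inner ℂ (Fiber.mk' s g hg z) (Fiber.mk' s g hg w) = inner ℂ z w := by
  obtain ⟨u, hu⟩ := Fiber.linearCoord_mk' s g hg
  change inner ℂ (Fiber.linearCoord s x _) (Fiber.linearCoord s x _) = _
  have h1 : (u : ℂ) * conj (u : ℂ) = 1 := by simp [Complex.mul_conj]
  rw [hu, hu, RCLike.inner_apply, RCLike.inner_apply, map_mul]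
  linear_combination w * conj z * h1

/-! ### Sections -/

/-- Sections of `ξ_s`. -/
abbrev Section (s : ℤ) : Type := (x : S2) → Fiber s x

/-- The section `g x₀ ↦ θ(g, f(g))` attached to a function `f` of type `s`. -/
def ofPullback {s : ℤ} (f : SO3 → ℂ) (_hf : IsOfType s f) : Section s :=
  fun x => Fiber.mk' s (frame x) (frame_smul x) (f (frame x))

theorem ofPullback_apply {s : ℤ} {f : SO3 → ℂ} (hf : IsOfType s f) {x : S2} (g : SO3)
    (hg : g • northPole = x) : ofPullback f hf x = Fiber.mk' s g hg (f g) := by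
  obtain ⟨k, hk⟩ := exists_mul_eq (frame_smul x) hg
  apply Fiber.ext
  refine (theta_eq_iff.2 ⟨k, hk, ?_⟩ : theta s (frame x) (f (frame x)) = theta s g (f g))
  rw [hk, hf]

/-- Square integrable (Borel measurable) sections of `ξ_s`. -/
def IsSquareIntegrable {s : ℤ} (u : Section s) : Prop :=
  Measurable (fun x => (u x).pt) ∧ ∫⁻ x, ‖u x‖ₑ ^ 2 ∂sphereMeasure < ⊤

/-- The scalar product `∫ ⟨u(x), v(x)⟩ dx` of `L²(ξ_s)`, linear in `u`. -/
def sectionInner {s : ℤ} (u v : Section s) : ℂ := ∫ x, inner ℂ (v x) (u x) ∂sphereMeasure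

/-- The pairs `(ℓ, m)` with `ℓ ≥ |s|` and `-ℓ ≤ m ≤ ℓ`. -/
abbrev Index (s : ℤ) : Type := {p : ℕ × ℤ // |s| ≤ p.1 ∧ |p.2| ≤ p.1}

theorem isOfType_conj_wignerD (s : ℤ) (i : Index s) :
    IsOfType s fun g => (Real.sqrt ((2 * i.1.1 + 1) / (4 * Real.pi)) : ℂ) *
      conj (wignerD i.1.1 i.1.2 s g) := by
  intro g k
  simp only [wignerD_mul i.2.1, map_mul, map_inv, Circle.coe_inv_eq_conj]
  ring

/-- The spin `-s` spherical harmonic `₋ₛY_{ℓ,m}`, the section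
`g x₀ ↦ θ(g, √((2ℓ+1) / 4π) conj (D^ℓ_{m,s}(g)))` of `ξ_s`, where `i = (ℓ, m)`. -/
def spinHarmonic (s : ℤ) (i : Index s) : Section s := ofPullback _ (isOfType_conj_wignerD s i)

/-- The entry `f^(ℓ)_{m,n} = √(2ℓ+1) ∫ f(g) D^ℓ_{m,n}(g⁻¹) dg` of the `ℓ`-th Fourier coefficient. -/
def fourierEntry (f : SO3 → ℂ) (ℓ : ℕ) (m n : ℤ) : ℂ :=
  Real.sqrt (2 * ℓ + 1) * ∫ g, f g * wignerD ℓ m n g⁻¹ ∂haarSO3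

end SpinSphere

end

open MeasureTheory Filter Topology SpinSphere
open scoped ComplexConjugate

namespace SpinSphere

/-! ### Binary forms under linear substitution -/

open Polynomial
open scoped Matrix

/-! The theorem is an explicit Peter–Weyl theorem for SO(3), restricted to one column of each `D^ℓ`
and transported to the line bundle.

Representations. SU(2) acts by substitution on binary forms of degree `N`. In the normalized
monomials the matrices of this action respect products (`formEntry_mul`) and adjoints
(`conj_formEntry`). For `N = 2ℓ` they descend to SO(3), so `D^ℓ` is a unitary representation. It is
diagonal on `K`, with the distinct weights `-ℓ, ..., ℓ`.

Orthogonality. Integrating products of entries over the Haar measure yields matrices that intertwine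
`D^ℓ` with `D^ℓ'`. Comparing weights kills every entry of an intertwiner between unequal weights.
The relation at the rotation by `π/2` about the second axis, where the last row and the last column
of `D^ℓ` have no zero entry, settles the rest: the intertwiner is `0` if `ℓ' < ℓ` and a scalar if `ℓ
= ℓ'`. This direct form of Schur's lemma does not go through irreducibility.

Completeness. An entry of `U` times a coefficient of degree `N` is a combination of coefficients of
degrees `N + 1` and `N - 1`, the Clebsch–Gordan rule for spin 1/2 (`entry_mul_mem_coeffSpan`). The
entries of a rotation are bilinear in `U` and its conjugate, so the span of all `D^ℓ_{m,n}` is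
stable under multiplication by them. It contains `1`, hence all polynomials in these entries, and
these are dense by Stone–Weierstrass. So the functions `√(2ℓ+1) D^ℓ_{m,n}` form a Hilbert basis of
`L²(SO(3))`.

Types. `D^ℓ_{m,n}` is of type `-n`, and functions of different types are orthogonal, so only the
column `-s` contributes to a function of type `s`. Sections of `ξ_s` correspond to functions of type
`s`, with the integral over the sphere equal to `4π` times the integral over SO(3). The conjugate of
such a function has type `-s`, and its expansion in the column `s`, conjugated, is the expansion in
spin harmonics. -/

/-- The image of `x^j y^(N-j)` under the substitution `(x, y) ↦ (x, y) M`, with `x = X`, `y = 1`. -/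
noncomputable def binaryForm (N j : ℕ) (M : Matrix (Fin 2) (Fin 2) ℂ) : ℂ[X] :=
  (C (M 0 0) * X + C (M 1 0)) ^ j * (C (M 0 1) * X + C (M 1 1)) ^ (N - j)

theorem homogenize_pow_one {R : Type*} [CommSemiring R] (p : R[X]) (hp : p.natDegree ≤ 1) (j : ℕ) :
    homogenize (p ^ j) j = homogenize p 1 ^ j := by
  induction j with
  | zero => simp
  | succ j ih =>
    rw [pow_succ, homogenize_mul _ _ _ hp, ih, pow_succ]
    simpa using natDegree_pow_le_of_le j hp

theorem natDegree_C_mul_X_add_C_le (a c : ℂ) : (C a * X + C c).natDegree ≤ 1 :=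
  Polynomial.natDegree_linear_le

theorem aeval_homogenize_eq_sum {S : Type*} [CommRing S] [Algebra ℂ S] (q : ℂ[X]) (N : ℕ)
    (A B : S) : MvPolynomial.aeval ![A, B] (homogenize q N) =
      ∑ k ∈ Finset.range (N + 1), q.coeff k • (A ^ k * B ^ (N - k)) := by
  rw [homogenize, Finset.Nat.sum_antidiagonal_eq_sum_range_succ_mk, map_sum]
  refine Finset.sum_congr rfl fun k _ => ?_
  rw [MvPolynomial.aeval_monomial, Finsupp.prod_fintype _ _ (by simp)]
  simp [Fin.prod_univ_two, Algebra.smul_def]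

theorem aeval_homogenize_linear {S : Type*} [CommRing S] [Algebra ℂ S] (a c : ℂ)
    (A B : S) : MvPolynomial.aeval ![A, B] (homogenize (C a * X + C c) 1) = a • A + c • B := by
  simp [Algebra.smul_def]

/-- Homogenizing undoes the normalization `y = 1`, after which arbitrary `A`, `B` of a commutative
algebra may be substituted for `x`, `y`. -/
theorem sum_coeff_binaryForm_smul {S : Type*} [CommRing S] [Algebra ℂ S] {N j : ℕ} (hj : j ≤ N)
    (M : Matrix (Fin 2) (Fin 2) ℂ) (A B : S) :
    ∑ k ∈ Finset.range (N + 1), (binaryForm N j M).coeff k • (A ^ k * B ^ (N - k)) =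
      (M 0 0 • A + M 1 0 • B) ^ j * (M 0 1 • A + M 1 1 • B) ^ (N - j) := by
  have h1 : ∀ a c : ℂ, ∀ n : ℕ, ((C a * X + C c) ^ n).natDegree ≤ n := fun a c n => by
    simpa using natDegree_pow_le_of_le n (natDegree_C_mul_X_add_C_le a c)
  rw [← aeval_homogenize_eq_sum, binaryForm]
  obtain ⟨n, rfl⟩ := Nat.exists_eq_add_of_le hj
  rw [Nat.add_sub_cancel_left, homogenize_mul _ _ (h1 _ _ _) (h1 _ _ _),
    homogenize_pow_one _ (natDegree_C_mul_X_add_C_le _ _), homogenize_pow_one _ (natDegree_C_mul_X_add_C_le _ _),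
    map_mul, map_pow, map_pow, aeval_homogenize_linear, aeval_homogenize_linear]

/-- Substituting `M'` and then `M` is substituting `M * M'`: take for `A`, `B` in
`sum_coeff_binaryForm_smul` the two linear forms given by the columns of `M`. -/
theorem coeff_binaryForm_mul {N j : ℕ} (hj : j ≤ N) (i : ℕ) (M M' : Matrix (Fin 2) (Fin 2) ℂ) :
    (binaryForm N j (M * M')).coeff i =
      ∑ k ∈ Finset.range (N + 1), (binaryForm N k M).coeff i * (binaryForm N j M').coeff k := by
  have h := sum_coeff_binaryForm_smul hj M' (C (M 0 0) * X + C (M 1 0))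
    (C (M 0 1) * X + C (M 1 1))
  have e : binaryForm N j (M * M') =
      ∑ k ∈ Finset.range (N + 1), (binaryForm N j M').coeff k • binaryForm N k M := by
    refine Eq.trans ?_ h.symm
    rw [binaryForm]
    congr 2 <;> simp only [Matrix.mul_apply, Fin.sum_univ_two, smul_eq_C_mul, map_add, map_mul] <;>
      ring
  rw [e, finsetSum_coeff]
  exact Finset.sum_congr rfl fun k _ => by rw [coeff_smul, smul_eq_mul, mul_comm]

theorem binaryForm_one {N j : ℕ} : binaryForm N j 1 = X ^ j := by
  simp [binaryForm]

theorem coeff_linear_pow (a c : ℂ) {n i : ℕ} (hi : i ≤ n) :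
    ((C a * X + C c) ^ n).coeff i = n.choose i * (a ^ i * c ^ (n - i)) := by
  rw [add_pow, finsetSum_coeff, Finset.sum_eq_single i]
  · have : (C a * X) ^ i * C c ^ (n - i) * ((n.choose i : ℕ) : ℂ[X]) =
      C (n.choose i * (a ^ i * c ^ (n - i))) * X ^ i := by
      simp only [map_mul, map_pow, map_natCast]; ring
    rw [this, coeff_C_mul, coeff_X_pow_self, mul_one]
  · intro k _ hk
    have : (C a * X) ^ k * C c ^ (n - k) * ((n.choose k : ℕ) : ℂ[X]) =
      C (n.choose k * (a ^ k * c ^ (n - k))) * X ^ k := by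
      simp only [map_mul, map_pow, map_natCast]; ring
    rw [this, coeff_C_mul, coeff_X_pow, if_neg (Ne.symm hk), mul_zero]
  · intro h
    exact absurd (Finset.mem_range.2 (Nat.lt_succ_of_le hi)) h

/-- The generating function `∑ k, N.choose k * y ^ k * binaryForm N k M` is the `N`-th power of the
bilinear expression `M 0 0 * y * X + M 0 1 * X + M 1 0 * y + M 1 1`, which is unchanged when `X`,
`y` are exchanged and `M` is transposed. The two sides are two readings of the coefficient of `X ^ i
* y ^ j`. -/
theorem choose_mul_coeff_binaryForm {N i j : ℕ} (hi : i ≤ N) (hj : j ≤ N)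
    (M : Matrix (Fin 2) (Fin 2) ℂ) :
    (N.choose j : ℂ) * (binaryForm N j M).coeff i = N.choose i * (binaryForm N i Mᵀ).coeff j := by
  have key : ∑ k ∈ Finset.range (N + 1), C ((N.choose k : ℂ) * (binaryForm N k M).coeff i) * X ^ k =
      C (N.choose i : ℂ) * binaryForm N i Mᵀ := by
    refine Polynomial.funext fun y => ?_
    have h : ∑ k ∈ Finset.range (N + 1), C ((N.choose k : ℂ) * y ^ k) * binaryForm N k M =
        (C (M 0 0 * y + M 0 1) * X + C (M 1 0 * y + M 1 1)) ^ N := by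
      have e : C (M 0 0 * y + M 0 1) * X + C (M 1 0 * y + M 1 1) =
          C y * (C (M 0 0) * X + C (M 1 0)) + (C (M 0 1) * X + C (M 1 1)) := by
        simp only [map_add, map_mul]; ring
      rw [e, add_pow]
      refine Finset.sum_congr rfl fun k _ => ?_
      simp only [binaryForm, map_mul, map_pow, map_natCast, mul_pow]
      ring
    have h' := congrArg (fun p : ℂ[X] => p.coeff i) h
    simp only [finsetSum_coeff, coeff_C_mul] at h'
    rw [coeff_linear_pow _ _ hi] at h'
    simp only [eval_finsetSum, eval_mul, eval_C, eval_pow, eval_X]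
    rw [binaryForm]
    simp only [eval_mul, eval_C, eval_pow, eval_X, eval_add, Matrix.transpose_apply]
    rw [← h']
    exact Finset.sum_congr rfl fun k _ => by ring
  have h := congrArg (fun p : ℂ[X] => p.coeff j) key
  simp only [finsetSum_coeff, coeff_C_mul, coeff_X_pow, mul_ite, mul_one, mul_zero] at h
  rw [Finset.sum_ite_eq, if_pos (Finset.mem_range.2 (Nat.lt_succ_of_le hj))] at h
  exact h

theorem conj_coeff_binaryForm (N i j : ℕ) (M : Matrix (Fin 2) (Fin 2) ℂ) :
    conj ((binaryForm N j M).coeff i) = (binaryForm N j (M.map conj)).coeff i := by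
  have : binaryForm N j (M.map conj) = (binaryForm N j M).map (starRingEnd ℂ) := by
    simp [binaryForm, Polynomial.map_mul, Polynomial.map_pow]
  rw [this, coeff_map]

/-! ### Recurrences -/

/-- With `L₀`, `L₁` the two linear factors, `M 0 0 * L₁ - M 0 1 * L₀ = det M = 1`. This replaces `M
0 1 * L₀` in the second term of the product rule, so that the product of an entry with a form of
degree `N` appears through forms of degrees `N + 1` and `N - 1`. -/
theorem derivative_binaryForm_succ_succ {M : Matrix (Fin 2) (Fin 2) ℂ} (hM : M.det = 1) {N j : ℕ}
    (hj : j ≤ N) :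
    derivative (binaryForm (N + 1) (j + 1) M) + C ((N - j : ℕ) : ℂ) * binaryForm (N - 1) j M =
      C ((N + 1) * M 0 0) * binaryForm N j M := by
  rw [Matrix.det_fin_two] at hM
  have hM' : C (M 0 0) * C (M 1 1) - C (M 0 1) * C (M 1 0) = (1 : ℂ[X]) := by
    rw [← C_mul, ← C_mul, ← C_sub, hM, C_1]
  obtain ⟨n, rfl⟩ := Nat.exists_eq_add_of_le hj
  rcases n with _ | n
  -- For `j = N` the form of degree `N - 1` is not meaningful, but its factor `N - j` is zero.
  · simp [binaryForm, derivative_pow]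
    ring
  · have e1 : j + (n + 1) + 1 - (j + 1) = n + 1 := by omega
    have e2 : j + (n + 1) - j = n + 1 := by omega
    have e3 : j + (n + 1) - 1 - j = n := by omega
    simp only [binaryForm, e1, e2, e3, derivative_mul, derivative_pow, derivative_add,
      derivative_C, derivative_X, Nat.add_sub_cancel]
    push_cast
    simp only [map_add, map_mul, map_natCast, map_one]
    linear_combination (-(n + 1 : ℂ[X])) * (C (M 0 0) * X + C (M 1 0)) ^ j *
      (C (M 0 1) * X + C (M 1 1)) ^ n * hM'

theorem derivative_binaryForm_succ {M : Matrix (Fin 2) (Fin 2) ℂ} (hM : M.det = 1) {N j : ℕ}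
    (hj : j ≤ N) :
    derivative (binaryForm (N + 1) j M) - C (j : ℂ) * binaryForm (N - 1) (j - 1) M =
      C ((N + 1) * M 0 1) * binaryForm N j M := by
  rw [Matrix.det_fin_two] at hM
  have hM' : C (M 0 0) * C (M 1 1) - C (M 0 1) * C (M 1 0) = (1 : ℂ[X]) := by
    rw [← C_mul, ← C_mul, ← C_sub, hM, C_1]
  obtain ⟨n, rfl⟩ := Nat.exists_eq_add_of_le hj
  rcases j with _ | j
  · simp [binaryForm, derivative_pow]
    ring
  · have e1 : j + 1 + n + 1 - (j + 1) = n + 1 := by omega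
    have e2 : j + 1 + n - (j + 1) = n := by omega
    have e3 : j + 1 + n - 1 - j = n := by omega
    simp only [binaryForm, e1, e2, e3, derivative_mul, derivative_pow, derivative_add,
      derivative_C, derivative_X, Nat.add_sub_cancel]
    push_cast
    simp only [map_add, map_mul, map_natCast, map_one]
    linear_combination (j + 1 : ℂ[X]) * (C (M 0 0) * X + C (M 1 0)) ^ j *
      (C (M 0 1) * X + C (M 1 1)) ^ n * hM'

/-- The second row of `M` needs no derivative: one more linear factor raises the degree, and its `X`
term is the first-row case already treated. -/
theorem C_mul_binaryForm_of_fst (M : Matrix (Fin 2) (Fin 2) ℂ) {N j : ℕ} :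
    C (M 1 0) * binaryForm N j M =
      binaryForm (N + 1) (j + 1) M - X * (C (M 0 0) * binaryForm N j M) := by
  rw [binaryForm, binaryForm, Nat.add_sub_add_right]
  ring

theorem C_mul_binaryForm_of_snd (M : Matrix (Fin 2) (Fin 2) ℂ) {N j : ℕ} (hj : j ≤ N) :
    C (M 1 1) * binaryForm N j M =
      binaryForm (N + 1) j M - X * (C (M 0 1) * binaryForm N j M) := by
  rw [binaryForm, binaryForm, Nat.succ_sub hj, pow_succ]
  ring

/-- The span of the matrix coefficients of the representations of `SU(2)` on the forms of degree
`N`, for all `N` of the parity of `p`. -/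
noncomputable def coeffSpan (p : ℕ) : Submodule ℂ (SU2 → ℂ) :=
  Submodule.span ℂ {F | ∃ N i j : ℕ, N % 2 = p % 2 ∧ j ≤ N ∧
    F = fun U => (binaryForm N j U.1).coeff i}

theorem coeff_binaryForm_mem {p N j : ℕ} (hN : N % 2 = p % 2) (hj : j ≤ N) (i : ℕ) :
    (fun U : SU2 => (binaryForm N j U.1).coeff i) ∈ coeffSpan p :=
  Submodule.subset_span ⟨N, i, j, hN, hj, rfl⟩

/-- The Clebsch–Gordan rule for spin 1/2: both `N + 1` and `N - 1` have the parity of `p + 1`. -/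
theorem coeff_mul_binaryForm_mem {p N j : ℕ} (hN : N % 2 = p % 2) (hj : j ≤ N) (x y : Fin 2)
    (i : ℕ) : (fun U : SU2 => (C (U.1 x y) * binaryForm N j U.1).coeff i) ∈ coeffSpan (p + 1) := by
  have hup : (N + 1) % 2 = (p + 1) % 2 := by omega
  have hN0 : (N + 1 : ℂ) ≠ 0 := by exact_mod_cast Nat.succ_ne_zero N
  have h0 : ∀ i : ℕ,
      (fun U : SU2 => (C (U.1 0 0) * binaryForm N j U.1).coeff i) ∈ coeffSpan (p + 1) := by
    intro i
    have e : (fun U : SU2 => (C (U.1 0 0) * binaryForm N j U.1).coeff i) =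
        ((N + 1 : ℂ)⁻¹ * (i + 1)) • (fun U : SU2 => (binaryForm (N + 1) (j + 1) U.1).coeff (i + 1)) +
        ((N + 1 : ℂ)⁻¹ * (N - j : ℕ)) • (fun U : SU2 => (binaryForm (N - 1) j U.1).coeff i) := by
      funext U
      have h := congrArg (fun q : ℂ[X] => q.coeff i) (derivative_binaryForm_succ_succ U.det_eq hj)
      simp only [coeff_add, coeff_derivative, coeff_C_mul] at h
      simp only [coeff_C_mul, Pi.add_apply, Pi.smul_apply, smul_eq_mul]
      field_simp
      linear_combination -h
    rw [e]
    refine Submodule.add_mem _ (Submodule.smul_mem _ _ (coeff_binaryForm_mem hup (by omega) _)) ?_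
    rcases Nat.eq_zero_or_pos (N - j) with h | h
    · simp [h]
    · exact Submodule.smul_mem _ _ (coeff_binaryForm_mem (by omega) (by omega) _)
  have h1 : ∀ i : ℕ,
      (fun U : SU2 => (C (U.1 0 1) * binaryForm N j U.1).coeff i) ∈ coeffSpan (p + 1) := by
    intro i
    have e : (fun U : SU2 => (C (U.1 0 1) * binaryForm N j U.1).coeff i) =
        ((N + 1 : ℂ)⁻¹ * (i + 1)) • (fun U : SU2 => (binaryForm (N + 1) j U.1).coeff (i + 1)) -
        ((N + 1 : ℂ)⁻¹ * j) • (fun U : SU2 => (binaryForm (N - 1) (j - 1) U.1).coeff i) := by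
      funext U
      have h := congrArg (fun q : ℂ[X] => q.coeff i) (derivative_binaryForm_succ U.det_eq hj)
      simp only [coeff_sub, coeff_derivative, coeff_C_mul] at h
      simp only [coeff_C_mul, Pi.sub_apply, Pi.smul_apply, smul_eq_mul]
      field_simp
      linear_combination -h
    rw [e]
    refine Submodule.sub_mem _ (Submodule.smul_mem _ _ (coeff_binaryForm_mem hup (by omega) _)) ?_
    rcases Nat.eq_zero_or_pos j with h | h
    · simp [h]
    · exact Submodule.smul_mem _ _ (coeff_binaryForm_mem (by omega) (by omega) _)
  have hX : ∀ G : SU2 → ℂ[X], (∀ i, (fun U => (G U).coeff i) ∈ coeffSpan (p + 1)) →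
      ∀ i, (fun U => (X * G U).coeff i) ∈ coeffSpan (p + 1) := by
    intro G hG i
    rcases i with _ | i
    · simp only [mul_coeff_zero, coeff_X_zero, zero_mul]
      exact Submodule.zero_mem _
    · simpa only [coeff_X_mul] using hG i
  fin_cases x <;> fin_cases y <;> simp only [Fin.zero_eta, Fin.mk_one]
  · exact h0 i
  · exact h1 i
  · simp only [C_mul_binaryForm_of_fst, coeff_sub]
    exact Submodule.sub_mem _ (coeff_binaryForm_mem hup (by omega) _) (hX _ h0 i)
  · simp only [C_mul_binaryForm_of_snd _ hj, coeff_sub]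
    exact Submodule.sub_mem _ (coeff_binaryForm_mem hup (by omega) _) (hX _ h1 i)

theorem entry_mul_mem_coeffSpan {p : ℕ} {F : SU2 → ℂ} (hF : F ∈ coeffSpan p) (x y : Fin 2) :
    (fun U : SU2 => U.1 x y * F U) ∈ coeffSpan (p + 1) := by
  induction hF using Submodule.span_induction with
  | mem F h =>
    obtain ⟨N, i, j, hN, hj, rfl⟩ := h
    simpa only [coeff_C_mul] using coeff_mul_binaryForm_mem hN hj x y i
  | zero =>
    simp only [Pi.zero_apply, mul_zero]
    exact Submodule.zero_mem _
  | add F G _ _ hF hG =>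
    simpa only [Pi.add_apply, mul_add] using! Submodule.add_mem _ hF hG
  | smul c F _ hF =>
    simpa only [Pi.smul_apply, smul_eq_mul, mul_left_comm] using! Submodule.smul_mem _ c hF

/-! ### The unitary matrix coefficients -/

/-- The norm of the monomial `x^i y^(N-i)`. -/
noncomputable def formNorm (N i : ℕ) : ℝ := √(i.factorial * (N - i).factorial)

theorem formNorm_pos (N i : ℕ) : 0 < formNorm N i :=
  Real.sqrt_pos.2 (by positivity)

/-- The matrix coefficients of forms of degree `N` in the orthonormal basis of monomials. -/
noncomputable def formEntry (N i j : ℕ) (M : Matrix (Fin 2) (Fin 2) ℂ) : ℂ :=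
  (formNorm N i / formNorm N j : ℝ) * (binaryForm N j M).coeff i

theorem formEntry_mul {N j : ℕ} (hj : j ≤ N) (i : ℕ) (M M' : Matrix (Fin 2) (Fin 2) ℂ) :
    formEntry N i j (M * M') =
      ∑ k ∈ Finset.range (N + 1), formEntry N i k M * formEntry N k j M' := by
  rw [formEntry, coeff_binaryForm_mul hj, Finset.mul_sum]
  refine Finset.sum_congr rfl fun k _ => ?_
  have hk : (formNorm N k : ℂ) ≠ 0 := by exact_mod_cast (formNorm_pos N k).ne'
  have h : (formNorm N j : ℂ) ≠ 0 := by exact_mod_cast (formNorm_pos N j).ne'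
  simp only [formEntry]
  push_cast
  field_simp

theorem formEntry_one (N i j : ℕ) : formEntry N i j 1 = if i = j then 1 else 0 := by
  rw [formEntry, binaryForm_one, coeff_X_pow]
  split_ifs with h
  · rw [h, div_self (formNorm_pos N j).ne']; simp
  · simp

/-- The normalization is chosen for this symmetry: `formNorm N k ^ 2 * N.choose k = N.factorial` for
every `k ≤ N`, which absorbs the binomials of `choose_mul_coeff_binaryForm`. Together with
conjugation of the entries it makes the representation unitary. -/
theorem formEntry_transpose {N i j : ℕ} (hi : i ≤ N) (hj : j ≤ N)
    (M : Matrix (Fin 2) (Fin 2) ℂ) : formEntry N j i Mᵀ = formEntry N i j M := by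
  have key := choose_mul_coeff_binaryForm hi hj M
  have hsq : ∀ k, k ≤ N → (formNorm N k : ℂ) ^ 2 * N.choose k = N.factorial := by
    intro k hk
    have h1 : formNorm N k ^ 2 = k.factorial * (N - k).factorial := Real.sq_sqrt (by positivity)
    have h2 := Nat.choose_mul_factorial_mul_factorial hk
    have h3 : formNorm N k ^ 2 * N.choose k = N.factorial := by
      rw [h1, ← h2]; push_cast; ring
    exact_mod_cast h3
  have h1 : (formNorm N i : ℂ) ≠ 0 := by exact_mod_cast (formNorm_pos N i).ne'
  have h2 : (formNorm N j : ℂ) ≠ 0 := by exact_mod_cast (formNorm_pos N j).ne'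
  have hf : (N.factorial : ℂ) ≠ 0 := by exact_mod_cast N.factorial_ne_zero
  simp only [formEntry]
  push_cast
  rw [div_mul_eq_mul_div, div_mul_eq_mul_div, div_eq_div_iff h1 h2]
  apply mul_left_cancel₀ hf
  linear_combination (formNorm N i : ℂ) ^ 2 * (formNorm N j : ℂ) ^ 2 * (-key) +
    (formNorm N i : ℂ) ^ 2 * (binaryForm N j M).coeff i * hsq j hj -
    (formNorm N j : ℂ) ^ 2 * (binaryForm N i Mᵀ).coeff j * hsq i hi

theorem conj_formEntry {N i j : ℕ} (hi : i ≤ N) (hj : j ≤ N) (M : Matrix (Fin 2) (Fin 2) ℂ) :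
    conj (formEntry N i j M) = formEntry N j i Mᴴ := by
  have : Mᴴ = (M.map conj)ᵀ := rfl
  rw [this, formEntry_transpose hi hj, formEntry, formEntry, map_mul, conj_coeff_binaryForm,
    Complex.conj_ofReal]

/-- The last column consists of the normalized coefficients of a pure power `(M 0 0 * X + M 1 0) ^
N`, given by the binomial theorem. -/
theorem formEntry_last_ne_zero {N i : ℕ} (hi : i ≤ N) {M : Matrix (Fin 2) (Fin 2) ℂ}
    (h0 : M 0 0 ≠ 0) (h1 : M 1 0 ≠ 0) : formEntry N i N M ≠ 0 := by
  have e : (binaryForm N N M).coeff i = N.choose i * (M 0 0 ^ i * M 1 0 ^ (N - i)) := by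
    rw [← coeff_linear_pow _ _ hi, binaryForm, Nat.sub_self, pow_zero, mul_one]
  rw [formEntry, e]
  refine mul_ne_zero ?_ (mul_ne_zero ?_ (mul_ne_zero (pow_ne_zero _ h0) (pow_ne_zero _ h1)))
  · exact_mod_cast (div_pos (formNorm_pos N i) (formNorm_pos N N)).ne'
  · exact_mod_cast (Nat.choose_pos hi).ne'

theorem continuous_coeff_mul {Y : Type*} [TopologicalSpace Y] {P Q : Y → ℂ[X]}
    (hP : ∀ i, Continuous fun y => (P y).coeff i) (hQ : ∀ i, Continuous fun y => (Q y).coeff i)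
    (i : ℕ) : Continuous fun y => (P y * Q y).coeff i := by
  simp only [coeff_mul]
  exact continuous_finsetSum _ fun x _ => (hP _).mul (hQ _)

theorem continuous_coeff_pow {Y : Type*} [TopologicalSpace Y] {P : Y → ℂ[X]}
    (hP : ∀ i, Continuous fun y => (P y).coeff i) (n i : ℕ) :
    Continuous fun y => (P y ^ n).coeff i := by
  induction n generalizing i with
  | zero => simpa using continuous_const
  | succ n ih => simpa only [pow_succ] using continuous_coeff_mul ih hP i

theorem continuous_formEntry (N i j : ℕ) : Continuous (formEntry N i j) := by
  have h : ∀ x y i, Continuous fun M : Matrix (Fin 2) (Fin 2) ℂ =>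
      (C (M 0 x) * X + C (M 1 y)).coeff i := by
    intro x y i
    simp only [coeff_add, coeff_C_mul, coeff_C]
    refine ((continuous_id.matrix_elem 0 x).mul continuous_const).add ?_
    split_ifs
    · exact continuous_id.matrix_elem 1 y
    · exact continuous_const
  exact continuous_const.mul
    (continuous_coeff_mul (continuous_coeff_pow (h 0 0) j) (continuous_coeff_pow (h 1 1) _) i)

/-! ### Wigner's matrices as representations of `SO(3)` -/

/-- Wigner's matrix `D^ℓ`, with rows and columns numbered from `0` to `2ℓ`. -/
noncomputable def wignerMatrix (ℓ : ℕ) (g : SO3) : Matrix (Fin (2 * ℓ + 1)) (Fin (2 * ℓ + 1)) ℂ :=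
  fun i j => wignerD ℓ ((i : ℤ) - ℓ) ((j : ℤ) - ℓ) g

theorem abs_sub_le {ℓ : ℕ} (i : Fin (2 * ℓ + 1)) : |((i : ℕ) : ℤ) - ℓ| ≤ ℓ := by
  rw [abs_le]; omega

theorem spinEntry_sub (ℓ : ℕ) (i j : Fin (2 * ℓ + 1)) (U : SU2) :
    spinEntry ℓ ((i : ℤ) - ℓ) ((j : ℤ) - ℓ) U = formEntry (2 * ℓ) i j U.1 := by
  have e1 : ((ℓ : ℤ) + (i - ℓ)).toNat = i := by omega
  have e2 : ((ℓ : ℤ) + (j - ℓ)).toNat = j := by omega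
  have e3 : ((ℓ : ℤ) - (i - ℓ)).toNat = 2 * ℓ - i := by omega
  have e4 : ((ℓ : ℤ) - (j - ℓ)).toNat = 2 * ℓ - j := by omega
  rw [spinEntry, e1, e2, e3, e4, formEntry, formNorm, formNorm, binaryForm]

theorem wignerMatrix_apply {ℓ : ℕ} {U : SU2} {g : SO3} (hU : Covers U g)
    (i j : Fin (2 * ℓ + 1)) : wignerMatrix ℓ g i j = formEntry (2 * ℓ) i j U.1 := by
  rw [wignerMatrix, wignerD_eq (abs_sub_le j) _ hU, spinEntry_sub]

theorem Covers.one : Covers 1 1 := by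
  intro x
  simp

theorem Covers.inv {U : SU2} {g : SO3} (h : Covers U g) : Covers (star U) g⁻¹ := by
  intro x
  have hx := h (g.1ᵀ *ᵥ x)
  rw [Matrix.mulVec_mulVec, SO3.mul_transpose, Matrix.one_mulVec] at hx
  change hermitian (g.1ᵀ *ᵥ x) = U.1ᴴ * hermitian x * U.1ᴴᴴ
  rw [hx, Matrix.conjTranspose_conjTranspose]
  simp only [Matrix.mul_assoc, SU2.conjTranspose_mul, Matrix.mul_one]
  simp only [← Matrix.mul_assoc, SU2.conjTranspose_mul, Matrix.one_mul]

theorem wignerMatrix_mul (ℓ : ℕ) (g h : SO3) :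
    wignerMatrix ℓ (g * h) = wignerMatrix ℓ g * wignerMatrix ℓ h := by
  obtain ⟨U, hU⟩ := exists_covers g
  obtain ⟨V, hV⟩ := exists_covers h
  ext i j
  rw [wignerMatrix_apply (hU.mul hV), Matrix.mul_apply]
  refine (formEntry_mul (by omega) _ _ _).trans ?_
  rw [Finset.sum_range]
  exact Finset.sum_congr rfl fun k _ => by rw [wignerMatrix_apply hU, wignerMatrix_apply hV]

theorem wignerMatrix_one (ℓ : ℕ) : wignerMatrix ℓ 1 = 1 := by
  ext i j
  rw [wignerMatrix_apply Covers.one]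
  refine (formEntry_one _ _ _).trans ?_
  simp [Matrix.one_apply, Fin.ext_iff]

theorem wignerMatrix_inv (ℓ : ℕ) (g : SO3) : wignerMatrix ℓ g⁻¹ = (wignerMatrix ℓ g)ᴴ := by
  obtain ⟨U, hU⟩ := exists_covers g
  ext i j
  rw [wignerMatrix_apply hU.inv, Matrix.conjTranspose_apply, wignerMatrix_apply hU]
  exact (conj_formEntry (by omega) (by omega) _).symm

theorem wignerMatrix_conjTranspose_mul (ℓ : ℕ) (g : SO3) :
    (wignerMatrix ℓ g)ᴴ * wignerMatrix ℓ g = 1 := by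
  rw [← wignerMatrix_inv, ← wignerMatrix_mul, inv_mul_cancel, wignerMatrix_one]

theorem wignerMatrix_coe_K (ℓ : ℕ) (k : K) :
    wignerMatrix ℓ k = Matrix.diagonal fun i : Fin (2 * ℓ + 1) => (chi ((i : ℤ) - ℓ) k : ℂ) := by
  ext i j
  have h := wignerD_mul (abs_sub_le j) ((i : ℤ) - ℓ) 1 k
  rw [one_mul] at h
  have h1 := congrFun (congrFun (wignerMatrix_one ℓ) i) j
  rw [wignerMatrix] at h1 ⊢
  rw [h, h1, Matrix.one_apply, Matrix.diagonal_apply]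
  split_ifs with hij
  · rw [hij, one_mul]
  · rw [zero_mul]

/-! ### Continuity -/

theorem SU2.isCompact : IsCompact
    (Matrix.specialUnitaryGroup (Fin 2) ℂ : Set (Matrix (Fin 2) (Fin 2) ℂ)) := by
  have hbox : IsCompact (Set.pi Set.univ fun _ : Fin 2 => Set.pi Set.univ fun _ : Fin 2 =>
      Metric.closedBall (0 : ℂ) 1) :=
    isCompact_univ_pi fun _ => isCompact_univ_pi fun _ => isCompact_closedBall 0 1
  have hset : (Matrix.specialUnitaryGroup (Fin 2) ℂ : Set (Matrix (Fin 2) (Fin 2) ℂ)) =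
      {A | A * Aᴴ = 1} ∩ {A | A.det = 1} := by
    ext A
    exact ⟨fun h => ⟨SU2.mul_conjTranspose ⟨A, h⟩, SU2.det_eq ⟨A, h⟩⟩, fun h =>
      Matrix.mem_specialUnitaryGroup_iff.2 ⟨Matrix.mem_unitaryGroup_iff.2 h.1, h.2⟩⟩
  refine IsCompact.of_isClosed_subset hbox ?_ ?_
  · rw [hset]
    exact (isClosed_eq (continuous_id.matrix_mul continuous_id.matrix_conjTranspose)
      continuous_const).inter (isClosed_eq continuous_id.matrix_det continuous_const)
  · intro A hA i _ j _
    rw [mem_closedBall_zero_iff]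
    exact entry_norm_bound_of_unitary (Matrix.mem_specialUnitaryGroup_iff.1 hA).1 i j

instance : CompactSpace SU2 := isCompact_iff_compactSpace.1 SU2.isCompact

/-- The lift to SU(2) is chosen pointwise, with no continuity. Instead, the preimage of a closed set
is the projection to SO(3) of a closed subset of SU(2) × SO(3), and this projection is a closed map
because SU(2) is compact. -/
theorem continuous_wignerMatrix (ℓ : ℕ) (i j : Fin (2 * ℓ + 1)) :
    Continuous fun g => wignerMatrix ℓ g i j := by
  have hF : Continuous fun U : SU2 => formEntry (2 * ℓ) i j U.1 :=
    (continuous_formEntry _ _ _).comp continuous_subtype_val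
  rw [continuous_iff_isClosed]
  intro s hs
  have hH : Continuous hermitian := by
    refine continuous_matrix fun a b => ?_
    fin_cases a <;> fin_cases b <;> simp [hermitian] <;> fun_prop
  have hcov : IsClosed {p : SU2 × SO3 | Covers p.1 p.2} := by
    simp only [Covers, Set.ofPred_forall]
    refine isClosed_iInter fun x => isClosed_eq ?_ ?_
    · exact hH.comp ((continuous_subtype_val.comp continuous_snd).matrix_mulVec continuous_const)
    · have : Continuous fun p : SU2 × SO3 => p.1.1 := continuous_subtype_val.comp continuous_fst
      exact (this.matrix_mul continuous_const).matrix_mul this.matrix_conjTranspose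
  have himg : (fun g => wignerMatrix ℓ g i j) ⁻¹' s =
      Prod.snd '' ({p : SU2 × SO3 | Covers p.1 p.2} ∩
        (fun p : SU2 × SO3 => formEntry (2 * ℓ) i j p.1.1) ⁻¹' s) := by
    ext g
    constructor
    · intro hg
      obtain ⟨U, hU⟩ := exists_covers g
      refine ⟨(U, g), ⟨hU, ?_⟩, rfl⟩
      rw [Set.mem_preimage, wignerMatrix_apply hU] at hg
      exact hg
    · rintro ⟨⟨U, g⟩, ⟨hU, hs⟩, rfl⟩
      rw [Set.mem_preimage, wignerMatrix_apply hU]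
      exact hs
  rw [himg]
  exact isClosedMap_snd_of_compactSpace _ (hcov.inter (hs.preimage (hF.comp continuous_fst)))

/-! ### Intertwining matrices -/

theorem axialPhase_rotZ (θ : ℝ) : axialPhase ⟨rotZ θ, rotZ_mem_K θ⟩ = Circle.exp θ := by
  apply Circle.ext
  change (⟨Real.cos θ, Real.sin θ⟩ : ℂ) = _
  rw [Circle.coe_exp, Complex.exp_mul_I]
  apply Complex.ext <;> simp [← Complex.ofReal_cos, ← Complex.ofReal_sin]

theorem exists_chi_ne {a b : ℤ} (hab : a ≠ b) : ∃ k : K, chi a k ≠ chi b k := by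
  have hab' : ((a - b : ℤ) : ℝ) ≠ 0 := by exact_mod_cast sub_ne_zero.2 hab
  -- At the angle `π / (a - b)` the quotient of the two characters is `exp (i π) = -1`.
  refine ⟨⟨rotZ (Real.pi / (a - b : ℤ)), rotZ_mem_K _⟩, fun h => ?_⟩
  have e : ∀ s : ℤ, chi s ⟨rotZ (Real.pi / (a - b : ℤ)), rotZ_mem_K _⟩ =
      Circle.exp (Real.pi / (a - b : ℤ)) ^ s := fun s => by
    rw [← axialPhase_rotZ]; rfl
  rw [e, e] at h
  have h2 : Circle.exp (Real.pi / (a - b : ℤ)) ^ (a - b) = 1 := by rw [zpow_sub, h, mul_inv_cancel]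
  rw [← Circle.exp_zsmul, zsmul_eq_mul, mul_div_cancel₀ _ hab'] at h2
  have h3 := congrArg (fun z : Circle => (z : ℂ)) h2
  simp [Circle.coe_exp] at h3
  norm_num at h3

theorem tilt_entry_ne_zero (x y : Fin 2) : (tilt (Real.pi / 2)).1 x y ≠ 0 := by
  have e : Real.pi / 2 / 2 = Real.pi / 4 := by ring
  fin_cases x <;> fin_cases y <;>
    simp [tilt, e, -Complex.ofReal_cos, -Complex.ofReal_sin, Real.cos_pi_div_four,
      Real.sin_pi_div_four]

theorem wignerMatrix_rotY_last_ne_zero (ℓ : ℕ) (i : Fin (2 * ℓ + 1)) :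
    wignerMatrix ℓ (rotY (Real.pi / 2)) i (Fin.last _) ≠ 0 := by
  rw [wignerMatrix_apply (covers_tilt _)]
  exact formEntry_last_ne_zero (by omega) (tilt_entry_ne_zero _ _) (tilt_entry_ne_zero _ _)

theorem wignerMatrix_last_rotY_ne_zero (ℓ : ℕ) (i : Fin (2 * ℓ + 1)) :
    wignerMatrix ℓ (rotY (Real.pi / 2)) (Fin.last _) i ≠ 0 := by
  -- Transposing turns the last row into the last column, so the entries needed are those of the
  -- first row of `tilt`.
  rw [wignerMatrix_apply (covers_tilt _), ← formEntry_transpose (by simp) (by omega)]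
  exact formEntry_last_ne_zero (by omega) (tilt_entry_ne_zero 0 0) (tilt_entry_ne_zero 0 1)

/-- On `K` both representations are diagonal, so the relation at `k` multiplies `M i j` by the two
characters of `k`; some `k` separates them. -/
theorem intertwiner_apply_eq_zero {ℓ ℓ' : ℕ} {M : Matrix (Fin (2 * ℓ + 1)) (Fin (2 * ℓ' + 1)) ℂ}
    (hM : ∀ g, wignerMatrix ℓ g * M = M * wignerMatrix ℓ' g) {i : Fin (2 * ℓ + 1)}
    {j : Fin (2 * ℓ' + 1)} (hij : ((i : ℕ) : ℤ) - ℓ ≠ ((j : ℕ) : ℤ) - ℓ') : M i j = 0 := by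
  obtain ⟨k, hk⟩ := exists_chi_ne hij
  have h := congrFun (congrFun (hM k) i) j
  rw [wignerMatrix_coe_K, wignerMatrix_coe_K, Matrix.diagonal_mul, Matrix.mul_diagonal] at h
  by_contra h0
  refine hk (Circle.ext (mul_right_cancel₀ h0 ?_))
  rw [h, mul_comm]

/-- The weight `ℓ` does not occur in `D^ℓ'`, so the last row of `M` vanishes. In the last row of the
relation at `rotY (π / 2)` the right side is then zero, and the left side reduces to a nonzero entry
of `D^ℓ` times the only entry of column `j` of `M` that the weights allow. -/
theorem intertwiner_eq_zero {ℓ ℓ' : ℕ} (hℓ : ℓ' < ℓ)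
    {M : Matrix (Fin (2 * ℓ + 1)) (Fin (2 * ℓ' + 1)) ℂ}
    (hM : ∀ g, wignerMatrix ℓ g * M = M * wignerMatrix ℓ' g) : M = 0 := by
  ext i j
  by_cases hij : ((i : ℕ) : ℤ) - ℓ = ((j : ℕ) : ℤ) - ℓ'
  · have h := congrFun (congrFun (hM (rotY (Real.pi / 2))) (Fin.last _)) j
    rw [Matrix.mul_apply, Matrix.mul_apply, Finset.sum_eq_single i, Finset.sum_eq_zero] at h
    · exact (mul_eq_zero.1 h).resolve_left (wignerMatrix_last_rotY_ne_zero ℓ i)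
    · intro k _
      rw [intertwiner_apply_eq_zero hM, zero_mul]
      rw [Fin.val_last]
      omega
    · intro k _ hk
      rw [intertwiner_apply_eq_zero hM, mul_zero]
      intro h'
      exact hk (Fin.ext (by omega))
    · simp
  · exact intertwiner_apply_eq_zero hM hij

/-- The weights are distinct, so `M` is diagonal. The entries of the relation at `rotY (π / 2)` in
the last column compare each `M i i` with the last diagonal entry. -/
theorem intertwiner_eq_smul_one {ℓ : ℕ} {M : Matrix (Fin (2 * ℓ + 1)) (Fin (2 * ℓ + 1)) ℂ}
    (hM : ∀ g, wignerMatrix ℓ g * M = M * wignerMatrix ℓ g) :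
    M = M (Fin.last _) (Fin.last _) • 1 := by
  have h0 : ∀ i j, i ≠ j → M i j = 0 := fun i j hij =>
    intertwiner_apply_eq_zero hM fun h => hij (Fin.ext (by omega))
  ext i j
  rw [Matrix.smul_apply, Matrix.one_apply, smul_eq_mul]
  split_ifs with hij
  · subst hij
    have h := congrFun (congrFun (hM (rotY (Real.pi / 2))) i) (Fin.last _)
    rw [Matrix.mul_apply, Matrix.mul_apply, Finset.sum_eq_single (Fin.last _),
      Finset.sum_eq_single i] at h
    · rw [mul_one]
      apply mul_right_cancel₀ (wignerMatrix_rotY_last_ne_zero ℓ i)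
      rw [← h, mul_comm]
    · intro k _ hk
      rw [h0 _ _ hk.symm, zero_mul]
    · simp
    · intro k _ hk
      rw [h0 _ _ hk, mul_zero]
    · simp
  · rw [h0 _ _ hij, mul_zero]

/-! ### Orthogonality relations -/

instance : IsProbabilityMeasure haarSO3 := ⟨by
  have := Measure.haarMeasure_self (G := SO3) (K₀ := ⊤)
  simpa [haarSO3] using this⟩

instance : haarSO3.IsHaarMeasure := inferInstanceAs (Measure.haarMeasure ⊤).IsHaarMeasure

instance : haarSO3.IsMulRightInvariant where
  map_mul_right_eq_self g := by
    have : IsProbabilityMeasure (haarSO3.map (· * g)) :=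
      Measure.isProbabilityMeasure_map (measurable_mul_const g).aemeasurable
    have : (haarSO3.map (· * g)).IsHaarMeasure := inferInstance
    -- A right translate of the Haar measure is again a Haar measure of mass one, hence equal to it
    -- by uniqueness.
    exact Measure.isHaarMeasure_eq_of_isProbabilityMeasure _ _

theorem integrable_of_continuous {f : SO3 → ℂ} (hf : Continuous f) : Integrable f haarSO3 :=
  hf.integrable_of_hasCompactSupport (HasCompactSupport.of_compactSpace f)

theorem integrable_wignerMatrix_mul_conj (ℓ ℓ' : ℕ) (i j : Fin (2 * ℓ + 1))
    (i' j' : Fin (2 * ℓ' + 1)) :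
    Integrable (fun g => wignerMatrix ℓ g i j * conj (wignerMatrix ℓ' g i' j')) haarSO3 :=
  integrable_of_continuous ((continuous_wignerMatrix ℓ i j).mul
    (Complex.continuous_conj.comp (continuous_wignerMatrix ℓ' i' j')))

/-- The matrix of scalar products of the entries of two columns intertwines the representations. -/
theorem integral_wignerMatrix_intertwines (ℓ ℓ' : ℕ) (j : Fin (2 * ℓ + 1)) (j' : Fin (2 * ℓ' + 1))
    (h : SO3) :
    wignerMatrix ℓ h * (Matrix.of fun i i' =>
        ∫ g, wignerMatrix ℓ g i j * conj (wignerMatrix ℓ' g i' j') ∂haarSO3) =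
      (Matrix.of fun i i' =>
        ∫ g, wignerMatrix ℓ g i j * conj (wignerMatrix ℓ' g i' j') ∂haarSO3) * wignerMatrix ℓ' h := by
  ext i i'
  simp only [Matrix.mul_apply, Matrix.of_apply]
  have e1 : ∑ k, wignerMatrix ℓ h i k *
        ∫ g, wignerMatrix ℓ g k j * conj (wignerMatrix ℓ' g i' j') ∂haarSO3 =
      ∫ g, wignerMatrix ℓ (h * g) i j * conj (wignerMatrix ℓ' g i' j') ∂haarSO3 := by
    simp only [wignerMatrix_mul, Matrix.mul_apply, Finset.sum_mul, mul_assoc]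
    rw [integral_finsetSum _ fun k _ => (integrable_wignerMatrix_mul_conj ..).const_mul _]
    simp only [integral_const_mul]
  have e2 : ∑ k, (∫ g, wignerMatrix ℓ g i j * conj (wignerMatrix ℓ' g k j') ∂haarSO3) *
        wignerMatrix ℓ' h k i' =
      ∫ g, wignerMatrix ℓ g i j * conj (wignerMatrix ℓ' (h⁻¹ * g) i' j') ∂haarSO3 := by
    simp only [wignerMatrix_mul, wignerMatrix_inv, Matrix.mul_apply, map_sum, map_mul,
      Finset.mul_sum, Matrix.conjTranspose_apply, RCLike.star_def, Complex.conj_conj]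
    rw [integral_finsetSum]
    · refine Finset.sum_congr rfl fun k _ => ?_
      rw [← integral_mul_const]
      congr 1 with g
      ring
    · intro k _
      refine ((integrable_wignerMatrix_mul_conj ℓ ℓ' i j k j').const_mul
        (wignerMatrix ℓ' h k i')).congr (Eventually.of_forall fun g => ?_)
      simp only
      ring
  -- Left invariance: replacing `g` by `h⁻¹ * g` carries the integral of `e1` into that of `e2`.
  rw [e1, e2, ← integral_mul_left_eq_self _ h⁻¹]
  simp only [mul_inv_cancel_left]

theorem integral_wignerMatrix_mul_conj_of_ne {ℓ ℓ' : ℕ} (h : ℓ ≠ ℓ') (i j : Fin (2 * ℓ + 1))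
    (i' j' : Fin (2 * ℓ' + 1)) :
    ∫ g, wignerMatrix ℓ g i j * conj (wignerMatrix ℓ' g i' j') ∂haarSO3 = 0 := by
  wlog hlt : ℓ' < ℓ generalizing ℓ ℓ'
  · have := this h.symm i' j' i j (by omega)
    rw [← map_eq_zero (starRingEnd ℂ), ← integral_conj] at this
    simpa only [map_mul, Complex.conj_conj, mul_comm] using this
  · exact congrFun (congrFun (intertwiner_eq_zero hlt
      (integral_wignerMatrix_intertwines ℓ ℓ' j j')) i) i'

theorem integral_wignerMatrix_mul_conj (ℓ : ℕ) (i j i' j' : Fin (2 * ℓ + 1)) :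
    ∫ g, wignerMatrix ℓ g i j * conj (wignerMatrix ℓ g i' j') ∂haarSO3 =
      if i = i' ∧ j = j' then (2 * ℓ + 1 : ℂ)⁻¹ else 0 := by
  have hM := intertwiner_eq_smul_one (integral_wignerMatrix_intertwines ℓ ℓ j j')
  set c := (Matrix.of fun i i' =>
    ∫ g, wignerMatrix ℓ g i j * conj (wignerMatrix ℓ g i' j') ∂haarSO3)
      (Fin.last (2 * ℓ)) (Fin.last _) with hc
  have hM' : ∀ i i', ∫ g, wignerMatrix ℓ g i j * conj (wignerMatrix ℓ g i' j') ∂haarSO3 =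
      if i = i' then c else 0 := fun i i' => by
    simpa [Matrix.one_apply] using congrFun (congrFun hM i) i'
  -- The scalar is found from the trace: the sum over `i` of the integrands is an entry of `D* D =
  -- 1`.
  have htr : (2 * ℓ + 1 : ℂ) * c = if j = j' then 1 else 0 := by
    have h1 : ∑ i, ∫ g, wignerMatrix ℓ g i j * conj (wignerMatrix ℓ g i j') ∂haarSO3 =
        if j = j' then 1 else 0 := by
      rw [← integral_finsetSum _ fun k _ => integrable_wignerMatrix_mul_conj ..]
      have : ∀ g, ∑ i, wignerMatrix ℓ g i j * conj (wignerMatrix ℓ g i j') =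
          if j = j' then 1 else 0 := fun g => by
        have := congrFun (congrFun (wignerMatrix_conjTranspose_mul ℓ g) j') j
        rw [Matrix.mul_apply, Matrix.one_apply] at this
        simp only [Matrix.conjTranspose_apply, RCLike.star_def] at this
        refine (Finset.sum_congr rfl fun k _ => mul_comm _ _).trans (this.trans ?_)
        simp only [eq_comm]
      simp [this]
    simp only [hM', if_true, Finset.sum_const, Finset.card_univ, Fintype.card_fin,
      nsmul_eq_mul] at h1
    rw [← h1]
    push_cast
    ring
  have hne : (2 * ℓ + 1 : ℂ) ≠ 0 := by exact_mod_cast Nat.succ_ne_zero (2 * ℓ)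
  rw [hM']
  by_cases hj : j = j'
  · rw [if_pos hj] at htr
    simp only [hj, and_true, ← eq_inv_of_mul_eq_one_right htr]
  · rw [if_neg hj] at htr
    simp [hj, (mul_eq_zero.1 htr).resolve_left hne]

/-- Right translation by an element of `K` preserves the integral and multiplies it by the value
there of a quotient of the two characters, which is not identically `1`. -/
theorem integral_eq_zero_of_isOfType {s s' : ℤ} {f f' : SO3 → ℂ} (hs : s ≠ s')
    (hf : IsOfType s f) (hf' : IsOfType s' f') : ∫ g, f g * conj (f' g) ∂haarSO3 = 0 := by
  obtain ⟨k, hk⟩ := exists_chi_ne hs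
  have h := integral_mul_right_eq_self (μ := haarSO3) (fun g => f g * conj (f' g)) (k⁻¹ : K).1
  have e : ∀ g, f (g * (k⁻¹ : K).1) * conj (f' (g * (k⁻¹ : K).1)) =
      ((chi s k : ℂ) * conj (chi s' k : ℂ)) * (f g * conj (f' g)) := fun g => by
    rw [hf, hf', inv_inv, map_mul]; ring
  simp only [e, integral_const_mul] at h
  by_contra h0
  apply hk
  have h1 := mul_right_cancel₀ h0 (h.trans (one_mul _).symm)
  rw [← Circle.coe_inv_eq_conj, ← Circle.coe_mul, ← Circle.coe_one] at h1
  exact eq_of_mul_inv_eq_one (Circle.ext h1)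

/-! ### Density of the span of the matrix coefficients -/

theorem conj_entry_mul_mem_coeffSpan {p : ℕ} {F : SU2 → ℂ} (hF : F ∈ coeffSpan p) (x y : Fin 2) :
    (fun U : SU2 => conj (U.1 x y) * F U) ∈ coeffSpan (p + 1) := by
  -- On SU(2) the adjoint is the adjugate, so conjugates of entries are entries up to sign.
  have hadj : ∀ U : SU2, U.1ᴴ = U.1.adjugate := fun U => by
    calc U.1ᴴ = U.1.adjugate * U.1 * U.1ᴴ := by
          rw [Matrix.adjugate_mul, SU2.det_eq, one_smul, Matrix.one_mul]
      _ = U.1.adjugate := by rw [Matrix.mul_assoc, SU2.mul_conjTranspose, Matrix.mul_one]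
  have e : ∀ U : SU2, conj (U.1 x y) = U.1.adjugate y x := fun U => by
    rw [← hadj, Matrix.conjTranspose_apply]; rfl
  simp only [e, Matrix.adjugate_fin_two]
  fin_cases x <;> fin_cases y <;> simp only [Fin.zero_eta, Fin.mk_one, Matrix.of_apply,
    Matrix.cons_val_zero, Matrix.cons_val_one, neg_mul]
  · exact entry_mul_mem_coeffSpan hF _ _
  · exact Submodule.neg_mem _ (entry_mul_mem_coeffSpan hF _ _)
  · exact Submodule.neg_mem _ (entry_mul_mem_coeffSpan hF _ _)
  · exact entry_mul_mem_coeffSpan hF _ _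

theorem conjugate_entry_mul_mem_coeffSpan {F : SU2 → ℂ} (hF : F ∈ coeffSpan 0)
    (A : Matrix (Fin 2) (Fin 2) ℂ) (x y : Fin 2) :
    (fun U : SU2 => (U.1 * A * U.1ᴴ) x y * F U) ∈ coeffSpan 0 := by
  -- Two factors shift the parity twice, and `coeffSpan` depends on its index only modulo 2.
  have h : ∀ a b, (fun U : SU2 => U.1 x a * (conj (U.1 y b) * F U)) ∈ coeffSpan 0 := fun a b =>
    entry_mul_mem_coeffSpan (conj_entry_mul_mem_coeffSpan hF y b) x a
  have e : (fun U : SU2 => (U.1 * A * U.1ᴴ) x y * F U) =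
      ∑ b, ∑ a, A a b • fun U : SU2 => U.1 x a * (conj (U.1 y b) * F U) := by
    funext U
    simp only [Matrix.mul_apply, Matrix.conjTranspose_apply, RCLike.star_def, Finset.sum_apply,
      Pi.smul_apply, smul_eq_mul, Finset.sum_mul]
    exact Finset.sum_congr rfl fun b _ => Finset.sum_congr rfl fun a _ => by ring
  rw [e]
  exact Submodule.sum_mem _ fun b _ => Submodule.sum_mem _ fun a _ => Submodule.smul_mem _ _ (h a b)

/-- The span of the entries of Wigner's matrices. -/
noncomputable def wignerSpan : Submodule ℂ (SO3 → ℂ) :=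
  Submodule.span ℂ (Set.range fun τ : (ℓ : ℕ) × (Fin (2 * ℓ + 1) × Fin (2 * ℓ + 1)) =>
    fun g => wignerMatrix τ.1 g τ.2.1 τ.2.2)

/-- An element of `SU(2)` above a rotation. -/
noncomputable def spinLift (g : SO3) : SU2 := (exists_covers g).choose

theorem covers_spinLift (g : SO3) : Covers (spinLift g) g := (exists_covers g).choose_spec

theorem wignerSpan_eq_map :
    wignerSpan = (coeffSpan 0).map (LinearMap.funLeft ℂ ℂ spinLift) := by
  apply le_antisymm
  · rw [wignerSpan, Submodule.span_le]
    rintro _ ⟨⟨ℓ, i, j⟩, rfl⟩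
    have hmem : (fun U : SU2 => (binaryForm (2 * ℓ) j U.1).coeff i) ∈ coeffSpan 0 :=
      coeff_binaryForm_mem (by omega) (by omega) i
    refine ⟨_, Submodule.smul_mem _ ((formNorm (2 * ℓ) i / formNorm (2 * ℓ) j : ℝ) : ℂ) hmem, ?_⟩
    funext g
    exact (wignerMatrix_apply (covers_spinLift g) i j).symm
  · rw [coeffSpan, Submodule.map_span, Submodule.span_le]
    rintro _ ⟨_, ⟨N, i, j, hN, hj, rfl⟩, rfl⟩
    obtain ⟨ℓ, rfl⟩ : ∃ ℓ, N = 2 * ℓ := ⟨N / 2, by omega⟩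
    by_cases hi : i ≤ 2 * ℓ
    · have e : LinearMap.funLeft ℂ ℂ spinLift (fun U => (binaryForm (2 * ℓ) j U.1).coeff i) =
          ((formNorm (2 * ℓ) j / formNorm (2 * ℓ) i : ℝ) : ℂ) • fun g =>
            wignerMatrix ℓ g ⟨i, by omega⟩ ⟨j, by omega⟩ := by
        funext g
        have h1 : (formNorm (2 * ℓ) i : ℂ) ≠ 0 := by exact_mod_cast (formNorm_pos _ i).ne'
        have h2 : (formNorm (2 * ℓ) j : ℂ) ≠ 0 := by exact_mod_cast (formNorm_pos _ j).ne'
        rw [Pi.smul_apply, wignerMatrix_apply (covers_spinLift g), formEntry, smul_eq_mul,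
          LinearMap.funLeft_apply]
        push_cast
        field_simp
      rw [e]
      exact Submodule.smul_mem _ _
        (Submodule.subset_span ⟨⟨ℓ, ⟨i, by omega⟩, ⟨j, by omega⟩⟩, rfl⟩)
    -- The form has degree at most `2 * ℓ` in `X`, so the coefficients beyond vanish.
    · have e : LinearMap.funLeft ℂ ℂ spinLift (fun U => (binaryForm (2 * ℓ) j U.1).coeff i) = 0 := by
        funext g
        have h1 : ∀ (a c : ℂ) (n : ℕ), ((C a * X + C c) ^ n).natDegree ≤ n := fun a c n => by
          simpa using natDegree_pow_le_of_le n (natDegree_C_mul_X_add_C_le a c)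
        change (binaryForm (2 * ℓ) j (spinLift g).1).coeff i = 0
        rw [binaryForm]
        refine coeff_eq_zero_of_natDegree_lt (lt_of_le_of_lt natDegree_mul_le ?_)
        have := h1 ((spinLift g).1 0 0) ((spinLift g).1 1 0) j
        have := h1 ((spinLift g).1 0 1) ((spinLift g).1 1 1) (2 * ℓ - j)
        omega
      rw [e]
      exact Submodule.zero_mem _

/-- Column `y` of `g` is read off from `hermitian (g e_y) = U * hermitian e_y * Uᴴ`, whose entries
act on the even span. The half sum and the half difference over `i` of the off-diagonal entries give
the first two coordinates. -/
theorem entry_mul_mem_wignerSpan {f : SO3 → ℂ} (hf : f ∈ wignerSpan) (x y : Fin 3) :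
    (fun g : SO3 => (g.1 x y : ℂ) * f g) ∈ wignerSpan := by
  have key : ∀ a b : Fin 2,
      (fun g : SO3 => hermitian (g.1 *ᵥ Pi.single y 1) a b * f g) ∈ wignerSpan := by
    intro a b
    rw [wignerSpan_eq_map] at hf ⊢
    obtain ⟨F, hF, rfl⟩ := hf
    refine ⟨_, conjugate_entry_mul_mem_coeffSpan hF (hermitian (Pi.single y 1)) a b, ?_⟩
    funext g
    rw [covers_spinLift g]
    rfl
  simp only [Matrix.mulVec_single_one, hermitian, Matrix.col_apply] at key
  fin_cases x <;> simp only [Fin.zero_eta, Fin.mk_one, Fin.reduceFinMk]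
  · have h := Submodule.smul_mem _ (1 / 2 : ℂ) (Submodule.add_mem _ (key 0 1) (key 1 0))
    refine (congrArg (· ∈ wignerSpan) (funext fun g => ?_)).mp h
    simp only [Pi.smul_apply, Pi.add_apply, smul_eq_mul, Matrix.of_apply, Matrix.cons_val_zero,
      Matrix.cons_val_one]
    ring
  · have h := Submodule.smul_mem _ (-Complex.I / 2 : ℂ) (Submodule.sub_mem _ (key 0 1) (key 1 0))
    refine (congrArg (· ∈ wignerSpan) (funext fun g => ?_)).mp h
    simp only [Pi.smul_apply, Pi.sub_apply, smul_eq_mul, Matrix.of_apply, Matrix.cons_val_zero,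
      Matrix.cons_val_one]
    linear_combination (-(g.1 1 y : ℂ) * f g) * Complex.I_sq
  · have h := key 0 0
    simpa only [Matrix.of_apply, Matrix.cons_val_zero] using h

/-- The entries of a rotation as continuous functions. -/
noncomputable def entryMap (x : Fin 3 × Fin 3) : C(SO3, ℂ) :=
  ⟨fun g => (g.1 x.1 x.2 : ℂ),
    Complex.continuous_ofReal.comp (continuous_subtype_val.matrix_elem x.1 x.2)⟩

theorem coe_mem_wignerSpan {h : C(SO3, ℂ)}
    (hh : h ∈ StarAlgebra.adjoin ℂ (Set.range entryMap)) : ⇑h ∈ wignerSpan := by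
  have hstar : Set.range entryMap ∪ star (Set.range entryMap) ⊆ Set.range entryMap := by
    rintro f (hf | ⟨x, hx⟩)
    · exact hf
    · refine ⟨x, ?_⟩
      rw [← star_star f, ← hx]
      ext g
      simp [entryMap]
  have hh' : h ∈ Algebra.adjoin ℂ (Set.range entryMap) := Algebra.adjoin_mono hstar hh
  clear hh
  -- Proving stability under multiplication by `h`, and applying it to `1 = D^0`, avoids expanding
  -- products of two Wigner entries.
  have key : ∀ f ∈ wignerSpan, ⇑h * f ∈ wignerSpan := by
    induction hh' using Algebra.adjoin_induction with
    | mem h hh =>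
      obtain ⟨x, rfl⟩ := hh
      exact fun f hf => entry_mul_mem_wignerSpan hf x.1 x.2
    | algebraMap r => exact fun f hf => Submodule.smul_mem _ r hf
    | add h h' _ _ ih ih' =>
      intro f hf
      rw [ContinuousMap.coe_add, add_mul]
      exact Submodule.add_mem _ (ih f hf) (ih' f hf)
    | mul h h' _ _ ih ih' =>
      intro f hf
      rw [ContinuousMap.coe_mul, mul_assoc]
      exact ih _ (ih' f hf)
  have h1 : (1 : SO3 → ℂ) ∈ wignerSpan := by
    refine Submodule.subset_span ⟨⟨0, 0, 0⟩, ?_⟩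
    funext g
    have e := wignerMatrix_apply (covers_spinLift g) (ℓ := 0) 0 0
    refine e.trans ?_
    simp [formEntry, binaryForm, formNorm]
  simpa using key 1 h1

theorem dense_wignerSpan : Dense {h : C(SO3, ℂ) | ⇑h ∈ wignerSpan} := by
  have hsep : (StarAlgebra.adjoin ℂ (Set.range entryMap)).SeparatesPoints := by
    intro g h hgh
    by_contra hcon
    push Not at hcon
    refine hgh (Subtype.ext (Matrix.ext fun x y => ?_))
    have := hcon _ ⟨entryMap (x, y), StarAlgebra.subset_adjoin _ _ ⟨_, rfl⟩, rfl⟩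
    exact Complex.ofReal_injective this
  have h := ContinuousMap.starSubalgebra_topologicalClosure_eq_top_of_separatesPoints _ hsep
  have hd : Dense (StarAlgebra.adjoin ℂ (Set.range entryMap) : Set C(SO3, ℂ)) := by
    rw [dense_iff_closure_eq, ← StarSubalgebra.topologicalClosure_coe, h]
    rfl
  exact hd.mono fun f hf => coe_mem_wignerSpan hf

/-! ### The Hilbert basis of `L²(SO(3))` -/

/-- The entries of Wigner's matrices as continuous functions. -/
noncomputable def wignerMap (τ : (ℓ : ℕ) × (Fin (2 * ℓ + 1) × Fin (2 * ℓ + 1))) : C(SO3, ℂ) :=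
  ⟨fun g => wignerMatrix τ.1 g τ.2.1 τ.2.2, continuous_wignerMatrix τ.1 τ.2.1 τ.2.2⟩

/-- The normalized entries of Wigner's matrices in `L²(SO(3))`. -/
noncomputable def wignerVec (τ : (ℓ : ℕ) × (Fin (2 * ℓ + 1) × Fin (2 * ℓ + 1))) :
    Lp ℂ 2 haarSO3 :=
  (√(2 * τ.1 + 1) : ℂ) • ContinuousMap.toLp 2 haarSO3 ℂ (wignerMap τ)

theorem sqrt_mul_sqrt_two_mul_add_one (ℓ : ℕ) :
    (√(2 * ℓ + 1) : ℂ) * (√(2 * ℓ + 1) : ℂ) = 2 * ℓ + 1 := by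
  have : √(2 * ℓ + 1) * √(2 * ℓ + 1) = 2 * ℓ + 1 := Real.mul_self_sqrt (by positivity)
  exact_mod_cast this

theorem orthonormal_wignerVec : Orthonormal ℂ wignerVec := by
  classical
  rw [orthonormal_iff_ite]
  rintro ⟨ℓ, i, j⟩ ⟨ℓ', i', j'⟩
  rw [wignerVec, wignerVec, inner_smul_left, inner_smul_right, ContinuousMap.inner_toLp]
  change _ * (_ * ∫ g, wignerMatrix ℓ' g i' j' * conj (wignerMatrix ℓ g i j) ∂haarSO3) = _
  rcases eq_or_ne ℓ' ℓ with rfl | h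
  · have hne : (2 * ℓ' + 1 : ℂ) ≠ 0 := by exact_mod_cast Nat.succ_ne_zero (2 * ℓ')
    rw [integral_wignerMatrix_mul_conj, Complex.conj_ofReal, ← mul_assoc,
      sqrt_mul_sqrt_two_mul_add_one]
    simp only [Sigma.mk.injEq, heq_eq_eq, true_and, Prod.mk.injEq, eq_comm (a := i'),
      eq_comm (a := j'), mul_ite, mul_zero, mul_inv_cancel₀ hne]
  · rw [integral_wignerMatrix_mul_conj_of_ne h, mul_zero, mul_zero, if_neg]
    exact fun e => h (congrArg Sigma.fst e).symm

theorem span_wignerVec_dense :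
    ⊤ ≤ (Submodule.span ℂ (Set.range wignerVec)).topologicalClosure := by
  intro F _
  have hd : Dense (ContinuousMap.toLp 2 haarSO3 ℂ '' {h : C(SO3, ℂ) | ⇑h ∈ wignerSpan}) :=
    (ContinuousMap.toLp_denseRange ℂ haarSO3 ℂ (p := 2) (by simp)).dense_image
      (ContinuousMap.toLp 2 haarSO3 ℂ).continuous dense_wignerSpan
  refine closure_mono ?_ (hd F)
  rintro _ ⟨h, hh, rfl⟩
  -- The span is taken among plain functions. Each generator comes from a continuous function whose
  -- class lies in the span of `wignerVec`; since a continuous function is determined by its values,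
  -- the same holds for `h`.
  have hle : wignerSpan ≤ (((Submodule.span ℂ (Set.range wignerVec)).comap
      (ContinuousMap.toLp 2 haarSO3 ℂ : C(SO3, ℂ) →L[ℂ] Lp ℂ 2 haarSO3).toLinearMap).map
        (ContinuousMap.coeFnLinearMap ℂ)) := by
    rw [wignerSpan, Submodule.span_le]
    rintro _ ⟨τ, rfl⟩
    refine ⟨wignerMap τ, ?_, rfl⟩
    have hne : (√(2 * τ.1 + 1) : ℂ) ≠ 0 := by
      have : √(2 * τ.1 + 1) ≠ 0 := (Real.sqrt_pos.2 (by positivity)).ne'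
      exact_mod_cast this
    have e : ContinuousMap.toLp 2 haarSO3 ℂ (wignerMap τ) =
        (√(2 * τ.1 + 1) : ℂ)⁻¹ • wignerVec τ := by
      rw [wignerVec, smul_smul, inv_mul_cancel₀ hne, one_smul]
    change ContinuousMap.toLp 2 haarSO3 ℂ (wignerMap τ) ∈ Submodule.span ℂ (Set.range wignerVec)
    rw [e]
    exact Submodule.smul_mem _ _ (Submodule.subset_span ⟨τ, rfl⟩)
  obtain ⟨h', hh', e⟩ := hle hh
  obtain rfl : h' = h := DFunLike.coe_injective e
  exact hh'

theorem hasSum_wigner {f : SO3 → ℂ} (hf : MemLp f 2 haarSO3) :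
    HasSum (fun τ : (ℓ : ℕ) × (Fin (2 * ℓ + 1) × Fin (2 * ℓ + 1)) =>
      ((2 * τ.1 + 1 : ℂ) * ∫ g, f g * conj (wignerMatrix τ.1 g τ.2.1 τ.2.2) ∂haarSO3) •
        ContinuousMap.toLp 2 haarSO3 ℂ (wignerMap τ)) (hf.toLp f) := by
  have h := (HilbertBasis.mk orthonormal_wignerVec span_wignerVec_dense).hasSum_repr (hf.toLp f)
  convert! h using 2 with τ
  rw [HilbertBasis.repr_apply_apply, HilbertBasis.coe_mk, wignerVec, inner_smul_left, smul_smul,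
    Complex.conj_ofReal]
  congr 1
  have e : inner ℂ (ContinuousMap.toLp 2 haarSO3 ℂ (wignerMap τ)) (hf.toLp f) =
      ∫ g, f g * conj (wignerMatrix τ.1 g τ.2.1 τ.2.2) ∂haarSO3 := by
    rw [L2.inner_def]
    apply integral_congr_ae
    filter_upwards [hf.coeFn_toLp, ContinuousMap.coeFn_toLp (p := 2) (𝕜 := ℂ) haarSO3 (wignerMap τ)]
      with g h1 h2
    rw [h1, h2]
    rfl
  rw [e, ← sqrt_mul_sqrt_two_mul_add_one]
  ring

/-! ### Expansion of functions of a given type -/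

/-- The position in the matrices `D^ℓ` of the entry `D^ℓ_{m,n}`, where `i = (ℓ, m)`. -/
def Index.position {s n : ℤ} (h : |n| = |s|) (i : Index s) :
    (ℓ : ℕ) × (Fin (2 * ℓ + 1) × Fin (2 * ℓ + 1)) :=
  ⟨i.1.1, ⟨(i.1.1 + i.1.2).toNat, by have := abs_le.1 i.2.2; omega⟩,
    ⟨(i.1.1 + n).toNat, by have := abs_le.1 (h.trans_le i.2.1); omega⟩⟩

theorem wignerMatrix_position {s n : ℤ} (h : |n| = |s|) (i : Index s) (g : SO3) :
    wignerMatrix (i.position h).1 g (i.position h).2.1 (i.position h).2.2 =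
      wignerD i.1.1 i.1.2 n g := by
  have h1 := abs_le.1 i.2.2
  have h2 := abs_le.1 (h.trans_le i.2.1)
  simp only [wignerMatrix, Index.position]
  congr 1 <;> omega

theorem Index.position_injective {s n : ℤ} (h : |n| = |s|) :
    Function.Injective (Index.position h : Index s → _) := by
  rintro ⟨⟨ℓ, m⟩, hi⟩ ⟨⟨ℓ', m'⟩, hi'⟩ e
  have e1 : ℓ = ℓ' := congrArg Sigma.fst e
  subst e1
  simp only [Index.position, Sigma.mk.injEq, heq_eq_eq, Prod.mk.injEq, Fin.mk.injEq, true_and] at e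
  have h1 := abs_le.1 hi.2
  have h2 := abs_le.1 hi'.2
  have : m = m' := by simp only at h1 h2; omega
  rw [Subtype.mk.injEq, Prod.mk.injEq]
  exact ⟨rfl, this⟩

theorem isOfType_wignerMatrix (ℓ : ℕ) (i j : Fin (2 * ℓ + 1)) :
    IsOfType (-(((j : ℕ) : ℤ) - ℓ)) fun g => wignerMatrix ℓ g i j := by
  intro g k
  have e : chi (-(((j : ℕ) : ℤ) - ℓ)) k⁻¹ = chi (((j : ℕ) : ℤ) - ℓ) k := by
    rw [map_inv, chi, chi, zpow_neg, MonoidHom.inv_apply, inv_inv]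
  rw [e, mul_comm]
  exact wignerD_mul (abs_sub_le j) _ g k

theorem wignerD_inv {ℓ : ℕ} {m n : ℤ} (hm : |m| ≤ ℓ) (hn : |n| ≤ ℓ) (g : SO3) :
    wignerD ℓ m n g⁻¹ = conj (wignerD ℓ n m g) := by
  have h1 := abs_le.1 hm
  have h2 := abs_le.1 hn
  have e := congrFun (congrFun (wignerMatrix_inv ℓ g) ⟨(ℓ + m).toNat, by omega⟩)
    ⟨(ℓ + n).toNat, by omega⟩
  have em : (((ℓ + m).toNat : ℕ) : ℤ) - ℓ = m := by omega
  have en : (((ℓ + n).toNat : ℕ) : ℤ) - ℓ = n := by omega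
  simpa only [Matrix.conjTranspose_apply, wignerMatrix, em, en, RCLike.star_def] using e

theorem continuous_wignerD {s n : ℤ} (h : |n| = |s|) (i : Index s) :
    Continuous (wignerD i.1.1 i.1.2 n) := by
  have e := funext (wignerMatrix_position h i)
  rw [← e]
  exact continuous_wignerMatrix _ _ _

theorem memLp_of_continuous {f : SO3 → ℂ} (hf : Continuous f) : MemLp f 2 haarSO3 :=
  hf.memLp_of_hasCompactSupport (HasCompactSupport.of_compactSpace f)

theorem integral_wignerD_mul_conj {s n : ℤ} (h : |n| = |s|) (i j : Index s) :
    ∫ g, wignerD i.1.1 i.1.2 n g * conj (wignerD j.1.1 j.1.2 n g) ∂haarSO3 =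
      if i = j then (2 * i.1.1 + 1 : ℂ)⁻¹ else 0 := by
  simp only [← wignerMatrix_position h]
  simp only [← (Index.position_injective h).eq_iff (a := i)]
  have key : ∀ τ τ' : (ℓ : ℕ) × (Fin (2 * ℓ + 1) × Fin (2 * ℓ + 1)),
      ∫ g, wignerMatrix τ.1 g τ.2.1 τ.2.2 * conj (wignerMatrix τ'.1 g τ'.2.1 τ'.2.2) ∂haarSO3 =
        if τ = τ' then (2 * τ.1 + 1 : ℂ)⁻¹ else 0 := by
    rintro ⟨ℓ, a, b⟩ ⟨ℓ', a', b'⟩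
    rcases eq_or_ne ℓ ℓ' with rfl | hne
    · rw [integral_wignerMatrix_mul_conj]
      simp only [Sigma.mk.injEq, heq_eq_eq, true_and, Prod.mk.injEq]
    · rw [integral_wignerMatrix_mul_conj_of_ne hne, if_neg]
      exact fun e => hne (congrArg Sigma.fst e)
  exact key _ _

/-- In the full expansion, an entry in a column other than `n` has a type other than `-n`, so its
coefficient vanishes and the sum may be reindexed by the column `n`. The form `|n| = |s|` serves
both `n = -s`, for functions, and `n = s`, for sections. -/
theorem tendsto_eLpNorm_sub_sum_wignerD {s n : ℤ} (h : |n| = |s|) {f : SO3 → ℂ}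
    (hf : IsOfType (-n) f) (hf2 : MemLp f 2 haarSO3) :
    Tendsto (fun F : Finset (Index s) => eLpNorm (fun g => f g - ∑ i ∈ F,
      ((2 * i.1.1 + 1 : ℂ) * ∫ g, f g * conj (wignerD i.1.1 i.1.2 n g) ∂haarSO3) *
        wignerD i.1.1 i.1.2 n g) 2 haarSO3) atTop (𝓝 0) := by
  have hsum := (Function.Injective.hasSum_iff (Index.position_injective h) ?_).2 (hasSum_wigner hf2)
  · have ht : Tendsto _ atTop _ := hsum
    rw [Lp.tendsto_Lp_iff_tendsto_eLpNorm] at ht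
    refine ht.congr fun F => ?_
    -- Convergence in `Lp` is expressed by partial sum minus limit; the sign is reversed here.
    rw [← eLpNorm_neg]
    apply eLpNorm_congr_ae
    have hc : ∀ᵐ g ∂haarSO3, ∀ i ∈ F, (ContinuousMap.toLp 2 haarSO3 ℂ
        (wignerMap (i.position h)) : SO3 → ℂ) g = wignerD i.1.1 i.1.2 n g := by
      rw [Finset.eventually_all]
      intro i _
      filter_upwards [ContinuousMap.coeFn_toLp (p := 2) (𝕜 := ℂ) haarSO3
        (wignerMap (i.position h))] with g hg
      rw [hg]
      exact wignerMatrix_position h i g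
    have hs : ∀ F : Finset (Index s), ∀ c : Index s → ℂ, ∀ v : Index s → Lp ℂ 2 haarSO3,
        ⇑(∑ i ∈ F, c i • v i) =ᵐ[haarSO3] fun g => ∑ i ∈ F, c i * v i g := by
      intro F c v
      classical
      induction F using Finset.induction_on with
      | empty => simpa using! Lp.coeFn_zero ℂ 2 haarSO3
      | insert a F ha ih =>
        rw [Finset.sum_insert ha]
        filter_upwards [ih, Lp.coeFn_add (c a • v a) (∑ i ∈ F, c i • v i),
          Lp.coeFn_smul (c a) (v a)] with g h1 h2 h3
        rw [h2, Pi.add_apply, h3, h1, Finset.sum_insert ha]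
        rfl
    filter_upwards [hc, hs F _ _] with g hg hsg
    simp only [Function.comp_apply, Pi.neg_apply, Pi.sub_apply, wignerMatrix_position] at hsg ⊢
    rw [hsg, neg_sub]
    congr 1
    exact Finset.sum_congr rfl fun i hi => by rw [hg i hi]; rfl
  · rintro ⟨ℓ, a, b⟩ hτ
    rw [integral_eq_zero_of_isOfType ?_ hf (isOfType_wignerMatrix ℓ a b), mul_zero, zero_smul]
    intro hn
    have ha := abs_sub_le a
    have hb := abs_sub_le b
    have hn' : n = ((b : ℕ) : ℤ) - ℓ := neg_inj.1 hn
    refine hτ ⟨⟨(ℓ, ((a : ℕ) : ℤ) - ℓ), ?_, ha⟩, ?_⟩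
    · rw [← h, hn']
      exact hb
    · have e1 : ((ℓ : ℤ) + (a - ℓ)).toNat = a := by omega
      have e2 : ((ℓ : ℤ) + (b - ℓ)).toNat = b := by omega
      simp only [Index.position, hn', e1, e2, Fin.eta]

/-! ### Sections and their pullbacks -/

instance : StandardBorelSpace SO3 :=
  have : IsClosed (Matrix.specialOrthogonalGroup (Fin 3) ℝ : Set (Matrix (Fin 3) (Fin 3) ℝ)) :=
    SO3.isCompact.isClosed
  have : PolishSpace (Matrix (Fin 3) (Fin 3) ℝ) :=
    inferInstanceAs (PolishSpace (Fin 3 → Fin 3 → ℝ))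
  have : PolishSpace SO3 := IsClosed.polishSpace ‹_›
  inferInstance

theorem continuous_smul_northPole : Continuous fun g : SO3 => g • northPole := by
  refine Continuous.subtype_mk ?_ _
  exact (PiLp.continuous_toLp 2 _).comp (continuous_subtype_val.matrix_mulVec continuous_const)

theorem surjective_smul_northPole : Function.Surjective fun g : SO3 => g • northPole :=
  fun x => ⟨frame x, frame_smul x⟩

/-- Measurability descends along a measurable surjection from a standard Borel space, so no
measurable choice of frame is needed. -/
theorem measurable_of_comp_smul_northPole {β : Type*} [MeasurableSpace β] {G : S2 → β}
    (h : Measurable fun g : SO3 => G (g • northPole)) : Measurable G :=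
  (continuous_smul_northPole.measurable.measurable_comp_iff_of_surjective
    surjective_smul_northPole).1 h

theorem continuous_of_comp_smul_northPole {β : Type*} [TopologicalSpace β] {G : S2 → β}
    (h : Continuous fun g : SO3 => G (g • northPole)) : Continuous G :=
  (continuous_smul_northPole.isClosedMap.isQuotientMap continuous_smul_northPole
    surjective_smul_northPole).continuous_iff.2 h

theorem lintegral_sphereMeasure {G : S2 → ENNReal} (hG : Measurable fun g : SO3 => G (g • northPole)) :
    ∫⁻ x, G x ∂sphereMeasure =
      ENNReal.ofReal (4 * Real.pi) * ∫⁻ g, G (g • northPole) ∂haarSO3 := by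
  rw [sphereMeasure, lintegral_smul_measure, lintegral_map (measurable_of_comp_smul_northPole hG)
    continuous_smul_northPole.measurable, smul_eq_mul]

theorem integral_sphereMeasure {G : S2 → ℂ} (hG : Measurable fun g : SO3 => G (g • northPole)) :
    ∫ x, G x ∂sphereMeasure = 4 * Real.pi * ∫ g, G (g • northPole) ∂haarSO3 := by
  rw [sphereMeasure, integral_smul_measure, integral_map
    continuous_smul_northPole.measurable.aemeasurable
    (measurable_of_comp_smul_northPole hG).aestronglyMeasurable,
    ENNReal.toReal_ofReal (by positivity)]
  simp

/-- The identification `z ↦ θ(g, z)` of `ℂ` with the fibre over `g x₀`. -/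
noncomputable def fiberEquiv (s : ℤ) (g : SO3) : ℂ ≃ₗ[ℂ] Fiber s (g • northPole) :=
  LinearEquiv.ofBijective
    { toFun := Fiber.mk' s g rfl
      map_add' := Fiber.mk'_add s g rfl
      map_smul' := Fiber.mk'_smul s g rfl } (Fiber.mk'_bijective s g rfl)

theorem norm_fiberEquiv {s : ℤ} (g : SO3) (z : ℂ) : ‖fiberEquiv s g z‖ = ‖z‖ := by
  obtain ⟨u, hu⟩ := Fiber.linearCoord_mk' s g rfl
  change ‖Fiber.linearCoord s _ (Fiber.mk' s g rfl z)‖ = _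
  rw [hu, norm_mul, Circle.norm_coe, one_mul]

/-- The function of type `s` attached to a section. -/
noncomputable def pullback {s : ℤ} (u : Section s) (g : SO3) : ℂ :=
  (fiberEquiv s g).symm (u (g • northPole))

theorem fiberEquiv_pullback {s : ℤ} (u : Section s) (g : SO3) :
    fiberEquiv s g (pullback u g) = u (g • northPole) :=
  LinearEquiv.apply_symm_apply _ _

theorem theta_pullback {s : ℤ} (u : Section s) (g : SO3) :
    theta s g (pullback u g) = (u (g • northPole)).pt :=
  congrArg Fiber.pt (fiberEquiv_pullback u g)

theorem theta_injective (s : ℤ) (g : SO3) : Function.Injective (theta s g) := fun _ _ h =>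
  (Fiber.mk'_bijective s g rfl).1 (Fiber.ext h)

theorem isOfType_pullback {s : ℤ} (u : Section s) : IsOfType s (pullback u) := by
  intro g k
  apply theta_injective s (g * k)
  have hk : (g * k.1) • northPole = g • northPole := by
    rw [mul_smul, show k.1 • northPole = northPole from k.2]
  rw [theta_pullback, hk, ← theta_pullback]
  exact theta_eq_iff.2 ⟨k, rfl, rfl⟩

theorem pullback_ofPullback {s : ℤ} {f : SO3 → ℂ} (hf : IsOfType s f) :
    pullback (ofPullback f hf) = f := by
  funext g
  rw [pullback, ofPullback_apply hf g rfl]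
  exact LinearEquiv.symm_apply_apply (fiberEquiv s g) (f g)

theorem measurable_pt_ofPullback {s : ℤ} {f : SO3 → ℂ} (hf : IsOfType s f) (hc : Continuous f) :
    Measurable fun x => (ofPullback f hf x).pt := by
  refine (continuous_of_comp_smul_northPole ?_).measurable
  simp only [← theta_pullback, pullback_ofPullback]
  exact continuous_quotient_mk'.comp (continuous_id.prodMk hc)

/-- The pairing of the line bundle with a function of type `s`. -/
noncomputable def pairing {s : ℤ} {h : SO3 → ℂ} (hh : IsOfType s h) : Total s → ℂ :=
  Quotient.lift (fun p => conj (h p.1) * p.2) (by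
    rintro ⟨g, z⟩ _ ⟨k, rfl⟩
    have e : conj (chi s k⁻¹ : ℂ) * (chi s k⁻¹ : ℂ) = 1 := by
      rw [mul_comm, Complex.mul_conj]; simp
    simp only [hh g k, map_mul]
    linear_combination (-(conj (h g) * z)) * e)

/-- The coordinate in a fibre must be recovered measurably from the point of the total space. A
single column of `D^|s|`, of type `s`, has unit length at every `g`, so `z` is the sum over `a` of
`D_{a,b}(g)` times the pairing of `D_{a,b}` with `θ(g, z)`, and these pairings are continuous on the
total space. -/
theorem measurable_pullback {s : ℤ} {u : Section s} (hu : Measurable fun x => (u x).pt) :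
    Measurable (pullback u) := by
  have hs := abs_le.1 (le_of_eq (Int.natCast_natAbs s).symm)
  set ℓ := s.natAbs with hℓ
  -- The position of the weight `-s`, whose column has type `s`.
  set b : Fin (2 * ℓ + 1) := ⟨(ℓ - s).toNat, by omega⟩ with hb
  have hb' : -(((b : ℕ) : ℤ) - ℓ) = s := by
    simp only [hb]
    omega
  have ht : ∀ a, IsOfType s fun g => wignerMatrix ℓ g a b := fun a => by
    have := isOfType_wignerMatrix ℓ a b
    rwa [hb'] at this
  have hc : ∀ a, Continuous (pairing (ht a)) := fun a => by
    refine Continuous.quotient_lift ?_ _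
    exact (Complex.continuous_conj.comp ((continuous_wignerMatrix ℓ a b).comp continuous_fst)).mul
      continuous_snd
  have e : pullback u = fun g =>
      ∑ a, wignerMatrix ℓ g a b * pairing (ht a) (u (g • northPole)).pt := by
    funext g
    have h1 := congrFun (congrFun (wignerMatrix_conjTranspose_mul ℓ g) b) b
    rw [Matrix.mul_apply, Matrix.one_apply_eq] at h1
    simp only [Matrix.conjTranspose_apply, RCLike.star_def] at h1
    rw [← one_mul (pullback u g), ← h1, Finset.sum_mul]
    refine Finset.sum_congr rfl fun a _ => ?_
    rw [← theta_pullback]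
    change _ = _ * (conj (wignerMatrix ℓ g a b) * pullback u g)
    ring
  rw [e]
  exact Finset.measurable_fun_sum _ fun a _ => (continuous_wignerMatrix ℓ a b).measurable.mul
    ((hc a).measurable.comp (hu.comp continuous_smul_northPole.measurable))

theorem lintegral_enorm_sq_eq (f : SO3 → ℂ) :
    ∫⁻ g, ‖f g‖ₑ ^ 2 ∂haarSO3 = eLpNorm f 2 haarSO3 ^ 2 := by
  have h := eLpNorm_nnreal_pow_eq_lintegral (f := f) (μ := haarSO3) (p := 2) (by norm_num)
  norm_num at h
  exact_mod_cast h.symm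

theorem lintegral_enorm_section_sq {s : ℤ} {u : Section s} (hu : Measurable (pullback u)) :
    ∫⁻ x, ‖u x‖ₑ ^ 2 ∂sphereMeasure =
      ENNReal.ofReal (4 * Real.pi) * eLpNorm (pullback u) 2 haarSO3 ^ 2 := by
  have e : ∀ g : SO3, ‖u (g • northPole)‖ₑ = ‖pullback u g‖ₑ := fun g => by
    rw [← fiberEquiv_pullback u g, ← ofReal_norm, norm_fiberEquiv, ofReal_norm]
  rw [lintegral_sphereMeasure] <;> simp only [e]
  · rw [lintegral_enorm_sq_eq]
  · exact hu.enorm.pow_const 2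

theorem sectionInner_eq {s : ℤ} {u v : Section s} (hu : Measurable (pullback u))
    (hv : Measurable (pullback v)) :
    sectionInner u v = 4 * Real.pi * ∫ g, pullback u g * conj (pullback v g) ∂haarSO3 := by
  have e : ∀ g : SO3, inner ℂ (v (g • northPole)) (u (g • northPole)) =
      pullback u g * conj (pullback v g) := fun g => by
    rw [← fiberEquiv_pullback u g, ← fiberEquiv_pullback v g]
    exact (Fiber.inner_mk' s g rfl _ _).trans (RCLike.inner_apply _ _)
  rw [sectionInner, integral_sphereMeasure] <;> simp only [e]
  exact hu.mul (Complex.continuous_conj.measurable.comp hv)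

theorem memLp_pullback {s : ℤ} {u : Section s} (hu : IsSquareIntegrable u) :
    MemLp (pullback u) 2 haarSO3 := by
  have hm := measurable_pullback hu.1
  refine ⟨hm.aestronglyMeasurable, ?_⟩
  have h := hu.2
  rw [lintegral_enorm_section_sq hm] at h
  by_contra h0
  rw [not_lt_top_iff] at h0
  rw [h0, ENNReal.top_pow two_ne_zero, ENNReal.mul_top] at h
  · exact lt_irrefl _ h
  · simpa using Real.pi_pos

theorem pullback_sub_sum {s : ℤ} {ι : Type*} (u : Section s) (F : Finset ι) (c : ι → ℂ)
    (v : ι → Section s) (g : SO3) :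
    pullback (fun x => u x - ∑ i ∈ F, c i • v i x) g =
      pullback u g - ∑ i ∈ F, c i * pullback (v i) g := by
  simp only [pullback, map_sub, map_sum, map_smul, smul_eq_mul]

/-! ### Spin spherical harmonics -/

theorem pullback_spinHarmonic (s : ℤ) (i : Index s) :
    pullback (spinHarmonic s i) = fun g =>
      (√((2 * i.1.1 + 1) / (4 * Real.pi)) : ℂ) * conj (wignerD i.1.1 i.1.2 s g) :=
  pullback_ofPullback _

theorem continuous_pullback_spinHarmonic (s : ℤ) (i : Index s) :
    Continuous (pullback (spinHarmonic s i)) := by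
  rw [pullback_spinHarmonic]
  exact continuous_const.mul (Complex.continuous_conj.comp (continuous_wignerD rfl i))

theorem isSquareIntegrable_spinHarmonic (s : ℤ) (i : Index s) :
    IsSquareIntegrable (spinHarmonic s i) := by
  have hc := continuous_pullback_spinHarmonic s i
  refine ⟨measurable_pt_ofPullback _ ?_, ?_⟩
  · rwa [pullback_spinHarmonic] at hc
  · rw [lintegral_enorm_section_sq hc.measurable]
    exact ENNReal.mul_lt_top ENNReal.ofReal_lt_top (ENNReal.pow_lt_top (memLp_of_continuous hc).2)

theorem four_pi_mul_sqrt_mul_sqrt (ℓ : ℕ) :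
    (4 * Real.pi : ℂ) * ((√((2 * ℓ + 1) / (4 * Real.pi)) : ℂ) *
      (√((2 * ℓ + 1) / (4 * Real.pi)) : ℂ)) = 2 * ℓ + 1 := by
  have h : √((2 * ℓ + 1) / (4 * Real.pi)) * √((2 * ℓ + 1) / (4 * Real.pi)) =
    (2 * ℓ + 1) / (4 * Real.pi) := Real.mul_self_sqrt (by positivity)
  have h' : 4 * Real.pi * ((2 * ℓ + 1) / (4 * Real.pi)) = 2 * ℓ + 1 :=
    mul_div_cancel₀ _ (by positivity)
  rw [← h] at h'
  exact_mod_cast h'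

theorem sectionInner_spinHarmonic (s : ℤ) (i j : Index s) :
    sectionInner (spinHarmonic s i) (spinHarmonic s j) = if i = j then 1 else 0 := by
  rw [sectionInner_eq (continuous_pullback_spinHarmonic s i).measurable
    (continuous_pullback_spinHarmonic s j).measurable, pullback_spinHarmonic, pullback_spinHarmonic]
  have e : ∀ g, (√((2 * i.1.1 + 1) / (4 * Real.pi)) : ℂ) * conj (wignerD i.1.1 i.1.2 s g) *
      conj ((√((2 * j.1.1 + 1) / (4 * Real.pi)) : ℂ) * conj (wignerD j.1.1 j.1.2 s g)) =
      ((√((2 * i.1.1 + 1) / (4 * Real.pi)) : ℂ) * (√((2 * j.1.1 + 1) / (4 * Real.pi)) : ℂ)) *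
        (wignerD j.1.1 j.1.2 s g * conj (wignerD i.1.1 i.1.2 s g)) := fun g => by
    rw [map_mul, Complex.conj_conj, Complex.conj_ofReal]; ring
  simp only [e, integral_const_mul]
  rw [integral_wignerD_mul_conj rfl]
  by_cases hij : i = j
  · subst hij
    have hne : (2 * i.1.1 + 1 : ℂ) ≠ 0 := by exact_mod_cast Nat.succ_ne_zero (2 * i.1.1)
    rw [if_pos rfl, if_pos rfl, ← mul_assoc, four_pi_mul_sqrt_mul_sqrt, mul_inv_cancel₀ hne]
  · rw [if_neg (Ne.symm hij), if_neg hij, mul_zero, mul_zero]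

/-- The harmonics pull back to multiples of conjugates of `D^ℓ_{m,s}`, so the column expansion is
applied to the conjugate of the pullback of `u`; conjugating the difference leaves its norm
unchanged. -/
theorem tendsto_lintegral_sub_sum_spinHarmonic {s : ℤ} {u : Section s}
    (hu : IsSquareIntegrable u) :
    Tendsto (fun F : Finset (Index s) =>
      ∫⁻ x, ‖u x - ∑ i ∈ F, sectionInner u (spinHarmonic s i) • spinHarmonic s i x‖ₑ ^ 2
        ∂sphereMeasure) atTop (𝓝 0) := by
  have hm := measurable_pullback hu.1
  have ht : IsOfType (-s) fun g => conj (pullback u g) := fun g k => by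
    have e : chi (-s) k⁻¹ = (chi s k⁻¹)⁻¹ := by
      rw [chi, chi, zpow_neg, MonoidHom.inv_apply]
    change conj (pullback u (g * k)) = _ * conj (pullback u g)
    rw [isOfType_pullback u g k, map_mul, e, Circle.coe_inv_eq_conj]
  have hL : MemLp (fun g => conj (pullback u g)) 2 haarSO3 := (memLp_pullback hu).star
  have h := tendsto_eLpNorm_sub_sum_wignerD rfl ht hL
  have h2 := ENNReal.Tendsto.const_mul (a := ENNReal.ofReal (4 * Real.pi))
    ((ENNReal.continuous_pow 2).tendsto 0 |>.comp h) (Or.inr ENNReal.ofReal_ne_top)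
  rw [zero_pow two_ne_zero, mul_zero] at h2
  refine h2.congr fun F => ?_
  have hp := funext (pullback_sub_sum u F (fun i => sectionInner u (spinHarmonic s i))
    (spinHarmonic s))
  rw [lintegral_enorm_section_sq, hp, Function.comp_apply]
  · congr 2
    refine eLpNorm_congr_norm_ae (Eventually.of_forall fun g => ?_)
    rw [← RCLike.norm_conj, map_sub, map_sum, Complex.conj_conj]
    congr 2
    refine Finset.sum_congr rfl fun i _ => ?_
    rw [sectionInner_eq hm (continuous_pullback_spinHarmonic s i).measurable,
      pullback_spinHarmonic]
    have e : ∀ g, pullback u g * conj ((√((2 * i.1.1 + 1) / (4 * Real.pi)) : ℂ) *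
        conj (wignerD i.1.1 i.1.2 s g)) = (√((2 * i.1.1 + 1) / (4 * Real.pi)) : ℂ) *
        conj (conj (pullback u g) * conj (wignerD i.1.1 i.1.2 s g)) := fun g => by
      simp only [map_mul, Complex.conj_conj, Complex.conj_ofReal]; ring
    simp only [e, integral_const_mul, integral_conj]
    -- Of the factor `2ℓ + 1`, one root and `4π` belong to the scalar product with the harmonic, the
    -- other root to the harmonic itself.
    rw [← four_pi_mul_sqrt_mul_sqrt]
    simp only [map_mul, Complex.conj_ofReal, map_ofNat]
    ring
  · rw [hp]
    exact hm.sub (Finset.measurable_fun_sum _ fun i _ =>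
      (continuous_pullback_spinHarmonic s i).measurable.const_mul _)

end SpinSphere

theorem mainTheorem8 :
    (∀ (s : ℤ) (f : SO3 → ℂ), IsOfType s f → MemLp f 2 haarSO3 →
      (∀ i : Index s, MemLp (wignerD i.1.1 i.1.2 (-s)) 2 haarSO3) ∧
      Tendsto (fun F : Finset (Index s) =>
        eLpNorm (fun g => f g - ∑ i ∈ F,
          (Real.sqrt (2 * i.1.1 + 1) * fourierEntry f i.1.1 (-s) i.1.2) *
            wignerD i.1.1 i.1.2 (-s) g) 2 haarSO3) atTop (𝓝 0)) ∧
    (∀ (s s' : ℤ) (f f' : SO3 → ℂ), s ≠ s' → IsOfType s f → IsOfType s' f' →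
      MemLp f 2 haarSO3 → MemLp f' 2 haarSO3 →
      ∫ g, f g * conj (f' g) ∂haarSO3 = 0) ∧
    (∀ s : ℤ,
      (∀ i : Index s, IsSquareIntegrable (spinHarmonic s i)) ∧
      (∀ i j : Index s, sectionInner (spinHarmonic s i) (spinHarmonic s j) =
        if i = j then 1 else 0) ∧
      (∀ u : Section s, IsSquareIntegrable u →
        Tendsto (fun F : Finset (Index s) =>
          ∫⁻ x, ‖u x - ∑ i ∈ F, sectionInner u (spinHarmonic s i) • spinHarmonic s i x‖ₑ ^ 2
            ∂sphereMeasure) atTop (𝓝 0))) := by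
  refine ⟨fun s f hf hf2 => ⟨fun i => memLp_of_continuous (continuous_wignerD (abs_neg s) i), ?_⟩,
    fun s s' f f' hs hf hf' _ _ => integral_eq_zero_of_isOfType hs hf hf',
    fun s => ⟨isSquareIntegrable_spinHarmonic s, sectionInner_spinHarmonic s,
      fun u hu => tendsto_lintegral_sub_sum_spinHarmonic hu⟩⟩
  have h := tendsto_eLpNorm_sub_sum_wignerD (abs_neg s) ((neg_neg s).symm ▸ hf) hf2
  refine h.congr fun F => ?_
  congr 1 with g
  congr 1
  refine Finset.sum_congr rfl fun i _ => ?_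
  have hs : |(-s)| ≤ i.1.1 := (abs_neg s).trans_le i.2.1
  -- The two roots combine to `2ℓ + 1`, and unitarity turns `D^ℓ_{-s,m}(g⁻¹)` into the conjugate of
  -- `D^ℓ_{m,-s}(g)`.
  rw [fourierEntry, ← mul_assoc, sqrt_mul_sqrt_two_mul_add_one]
  simp only [wignerD_inv hs i.2.2]
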